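/- **Setting.** A *time scale* is a nonempty closed set $\mathbb{T}\subset\mathbb{R}$, with forward jump $\sigma(t)=\inf\{s\in\mathbb{T}:s>t\}$ and graininess $\mu(t)=\sigma(t)-t$; $x^\Delta$ and $\int\cdot\,\Delta u$ denote the delta derivative and the delta integral on $\mathbb{T}$. A function on $\mathbb{T}$ is *rd-continuous* if it is continuous at right-dense points and has left-side limits at left-dense points; a function $q:\mathbb{T}\to\mathbb{R}$ is in $\mathcal{R}^+$ (*positively regressive*) if it is rd-continuous and $1+\mu(t)q(t)>0$ for all $t\in\mathbb{T}$. Put $\mathbb{T}_\tau=\mathbb{T}\cap(\mathbb{T}-\tau)$. $\mathbb{T}$ is *almost periodic* if for every $\varepsilon>0$ there is $l>0$ such that each interval of length $l$ contains a $\tau$ with $\mathbb{T}_\tau\ne\emptyset$ and $\mathrm{dist}(\mathbb{T},\mathbb{T}_\tau)<\varepsilon$, where $\mathrm{dist}(A,B)=\max\{\sup_{t\in A}\mathrm{dist}(t,B),\sup_{t\in B}\mathrm{dist}(t,A)\}$. Let $\Pi=\{\tau\in\mathbb{R}:\mathbb{T}_\tau\neq\emptyset\}$ and $\widetilde{\mathbb{T}}=\bigcap_{\tau\in\Pi}\mathbb{T}_\tau$.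 A bounded rd-continuous function $h$ from $\mathbb{T}$ to a Banach space is *almost automorphic* if every sequence in $\Pi$ has a subsequence $(s_n)$ such that $\bar h(t)=\lim_n h(t+s_n)$ exists for each $t\in\widetilde{\mathbb{T}}$ and $\lim_n\bar h(t-s_n)=h(t)$ for each $t\in\widetilde{\mathbb{T}}$. For such $h$ write $\overline{h}=\sup_{t\in\mathbb{T}}|h(t)|$ and, if $h$ is real-valued, $\underline{h}=\inf_{t\in\mathbb{T}}h(t)$. Let $\mathbb{B}$ be the space of almost automorphic functions $\varphi=\{\varphi_{ij}\}:\mathbb{T}\to\mathbb{R}^{m\times n}$ with norm $\|\varphi\|_{\mathbb{B}}=\sup_{t\in\mathbb{T}}\max_{i,j}|\varphi_{ij}(t)|$. **Theorem.** Let $\mathbb{T}$ be an almost periodic time scale, let $m,n\ge1$ and $r,p\ge0$ be integers, and consider, for $1\le i\le m$, $1\le j\le n$ and $t\in\mathbb{T}$, the shunting inhibitory cellular neural network $$x_{ij}^{\Delta}(t)=-a_{ij}(t)x_{ij}(t)-\sum_{C_{kl}\in N_r(i,j)}B_{ij}^{kl}(t)f(x_{kl}(t-\tau_{kl}(t)))x_{ij}(t)-\sum_{C_{kl}\in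 N_p(i,j)}C_{ij}^{kl}(t)\int_{t-\delta_{kl}(t)}^{t}g(x_{kl}(u))\,\Delta u\;x_{ij}(t)+L_{ij}(t),$$ where $N_r(i,j)=\{C_{kl}:\max(|k-i|,|l-j|)\le r,\ 1\le k\le m,\ 1\le l\le n\}$, and likewise for $N_p(i,j)$, and where $B_{ij}^{kl},C_{ij}^{kl}\ge 0$, $\underline{a_{ij}}>0$, and $t-\tau_{kl}(t),\,t-\delta_{kl}(t)\in\mathbb{T}$ for all $t\in\mathbb{T}$. Suppose that * $(H_1)$ $-a_{ij}\in\mathcal{R}^+$, and $a_{ij},B_{ij}^{kl},C_{ij}^{kl},\tau_{kl},\delta_{kl},L_{ij}:\mathbb{T}\to\mathbb{R}$ are almost automorphic for all indices; * $(H_2)$ $f,g:\mathbb{R}\to\mathbb{R}$ are continuous, and $L^f,L^g,M^f,M^g$ are positive constants such that for all $u,v\in\mathbb{R}$ $$|f(u)-f(v)|\le L^f|u-v|,\quad f(0)=0,\quad |f(u)|\le M^f|u|,$$ $$|g(u)-g(v)|\le L^g|u-v|,\quad g(0)=0,\quad |g(u)|\le M^g|u|;$$ if the constant $\rho$ of $(H_3)$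 satisfies $\rho\ge1$, then the bound $|f(u)|\le M^f|u|$ may be replaced by $|f(u)|\le M^f$ for all $u$, and, independently, $|g(u)|\le M^g|u|$ by $|g(u)|\le M^g$ for all $u$; * $(H_3)$ $\rho$ is a real constant such that $$\max_{i,j}\frac{\sum_{C_{kl}\in N_r(i,j)}\overline{B_{ij}^{kl}}M^f\rho^2+\sum_{C_{kl}\in N_p(i,j)}\overline{C_{ij}^{kl}}M^g\overline{\delta_{kl}}\rho^2+\overline{L_{ij}}}{\underline{a_{ij}}}<\rho,$$ $$\max_{i,j}\frac{\sum_{C_{kl}\in N_r(i,j)}\overline{B_{ij}^{kl}}(M^f+L^f)\rho+\sum_{C_{kl}\in N_p(i,j)}\overline{C_{ij}^{kl}}(M^g+L^g)\overline{\delta_{kl}}\rho}{\underline{a_{ij}}}<1.$$ Then the network has exactly one almost automorphic solution in $\{\varphi\in\mathbb{B}:\|\varphi\|_{\mathbb{B}}\le\rho\}$. -/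

import Mathlib

open Set Filter Topology MeasureTheory

noncomputable section

namespace TimeScale

/-- A time scale: a nonempty closed subset of the real line. Functions on `T` are represented by
functions on `ℝ`; only their values at points of `T` are ever used. -/
def IsTimeScale (T : Set ℝ) : Prop := T.Nonempty ∧ IsClosed T

open Classical in
/-- The forward jump operator `σ(t) = inf {s ∈ T : s > t}`, with `σ(t) = t` at a maximum of `T`. -/
def sigma (T : Set ℝ) (t : ℝ) : ℝ :=
  if (T ∩ Ioi t).Nonempty then sInf (T ∩ Ioi t) else t

open Classical in
/-- The backward jump operator `sup {s ∈ T : s < t}`, equal to `t` at a minimum of `T`. -/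
def backJump (T : Set ℝ) (t : ℝ) : ℝ :=
  if (T ∩ Iio t).Nonempty then sSup (T ∩ Iio t) else t

/-- The graininess function `μ(t) = σ(t) - t`. -/
def graininess (T : Set ℝ) (t : ℝ) : ℝ := sigma T t - t

/-- `t ∈ T` is right-dense: `t < sup T` and `σ(t) = t`. -/
def IsRightDense (T : Set ℝ) (t : ℝ) : Prop :=
  t ∈ T ∧ (T ∩ Ioi t).Nonempty ∧ sigma T t = t

/-- `t ∈ T` is left-dense: `t > inf T` and the backward jump of `t` is `t`. -/
def IsLeftDense (T : Set ℝ) (t : ℝ) : Prop :=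
  t ∈ T ∧ (T ∩ Iio t).Nonempty ∧ backJump T t = t

/-- Rd-continuity on `T`: continuity at right-dense points, left-side limits at left-dense
points. -/
def RdContinuous {X : Type*} [TopologicalSpace X] (T : Set ℝ) (f : ℝ → X) : Prop :=
  (∀ t, IsRightDense T t → ContinuousWithinAt f T t) ∧
  (∀ t, IsLeftDense T t → ∃ l : X, Tendsto f (𝓝[T ∩ Iio t] t) (𝓝 l))

/-- The class of positively regressive functions: rd-continuous with `1 + μ(t) q(t) > 0` on `T`. -/
def PositivelyRegressive (T : Set ℝ) (q : ℝ → ℝ) : Prop :=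
  RdContinuous T q ∧ ∀ t ∈ T, 0 < 1 + graininess T t * q t

/-- `f` is delta differentiable at `t` (as a function on `T`), with delta derivative `d`. -/
def HasDeltaDerivAt (T : Set ℝ) (f : ℝ → ℝ) (d t : ℝ) : Prop :=
  ∀ ε > 0, ∀ᶠ s in 𝓝[T] t,
    |f (sigma T t) - f s - d * (sigma T t - s)| ≤ ε * |sigma T t - s|

/-- The largest point of the time scale not exceeding `s`. -/
def floorPt (T : Set ℝ) (s : ℝ) : ℝ := sSup (T ∩ Iic s)

/-- The points `s` of the line with `inf T ≤ s < sup T`, at which `floorPt` is meaningful. -/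
def span (T : Set ℝ) : Set ℝ := {s | (T ∩ Iic s).Nonempty ∧ (T ∩ Ioi s).Nonempty}

/-- The Lebesgue delta measure of `T`. Moving the mass of every gap `(t, σ(t))` to its left end
point `t` gives the measure on `T` with `[a, b) ∩ T ↦ b - a` for `a ≤ b` in `T`
(see `deltaMeasure_Ico`). -/
def deltaMeasure (T : Set ℝ) : Measure ℝ :=
  Measure.map (floorPt T) ((volume : Measure ℝ).restrict (span T))

/-- The oriented delta integral `∫_a^b f(u) Δu` for `a, b ∈ T`. -/
def deltaIntegral (T : Set ℝ) (f : ℝ → ℝ) (a b : ℝ) : ℝ :=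
  (∫ u in Ico a b, f u ∂(deltaMeasure T)) - ∫ u in Ico b a, f u ∂(deltaMeasure T)

/-- `T_τ = T ∩ (T - τ)`. -/
def shiftInter (T : Set ℝ) (τ : ℝ) : Set ℝ := {t | t ∈ T ∧ t + τ ∈ T}

/-- The `ε`-translation numbers `τ` of `T`: those with `T_τ ≠ ∅` and `dist(T, T_τ) < ε`.
The distance is the maximum of `sup_{t ∈ T} dist(t, T_τ)` and `sup_{t ∈ T_τ} dist(t, T)`, with
values in `[0, ∞]`. -/
def translationNumbers (T : Set ℝ) (ε : ℝ) : Set ℝ :=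
  {τ | (shiftInter T τ).Nonempty ∧
    Metric.hausdorffEDist T (shiftInter T τ) < ENNReal.ofReal ε}

/-- Almost periodic time scale: for each `ε > 0` the `ε`-translation numbers are relatively
dense. -/
def IsAlmostPeriodic (T : Set ℝ) : Prop :=
  IsTimeScale T ∧
  ∀ ε > 0, ∃ l > 0, ∀ c : ℝ, ∃ τ ∈ Icc c (c + l), τ ∈ translationNumbers T ε

/-- `Π = {τ : T_τ ≠ ∅}`. -/
def shifts (T : Set ℝ) : Set ℝ := {τ | (shiftInter T τ).Nonempty}

/-- The intersection of all `T_τ`, `τ ∈ Π`. -/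
def core (T : Set ℝ) : Set ℝ := ⋂ τ ∈ shifts T, shiftInter T τ

/-- Almost automorphic functions on `T`: bounded and rd-continuous on `T`, and every sequence in `Π`
has a subsequence `s` with `f(t + s_n) → f'(t)` and `f'(t - s_n) → f(t)` for `t` in the core.
(For such `t` one has `t + s_n ∈ T`, and `t - s_n` lies in the core again.) -/
def AlmostAutomorphic {X : Type*} [NormedAddCommGroup X] (T : Set ℝ) (f : ℝ → X) : Prop :=
  (∃ K : ℝ, ∀ t ∈ T, ‖f t‖ ≤ K) ∧ RdContinuous T f ∧
  ∀ s' : ℕ → ℝ, (∀ k, s' k ∈ shifts T) →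
    ∃ θ : ℕ → ℕ, StrictMono θ ∧ ∃ f' : ℝ → X,
      (∀ t ∈ core T, Tendsto (fun k => f (t + s' (θ k))) atTop (𝓝 (f' t))) ∧
      (∀ t ∈ core T, Tendsto (fun k => f' (t - s' (θ k))) atTop (𝓝 (f t)))

/-- `sup_{t ∈ T} ‖f t‖`; used only for functions that are bounded on `T`. -/
def supNorm {X : Type*} [NormedAddCommGroup X] (T : Set ℝ) (f : ℝ → X) : ℝ :=
  sSup ((fun t => ‖f t‖) '' T)

/-- `inf_{t ∈ T} f t`. -/
def infVal (T : Set ℝ) (f : ℝ → ℝ) : ℝ := sInf (f '' T)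

/-- The `r`-neighbourhood of the cell at position `(i, j)` of the `m × n` lattice. -/
def nbhd {m n : ℕ} (r : ℕ) (i : Fin m) (j : Fin n) : Finset (Fin m × Fin n) :=
  Finset.univ.filter fun c =>
    max |((c.1 : ℕ) : ℤ) - ((i : ℕ) : ℤ)| |((c.2 : ℕ) : ℤ) - ((j : ℕ) : ℤ)| ≤ (r : ℤ)

/-- `x` solves the shunting inhibitory cellular neural network on `T`. -/
def IsSICNNSolution (T : Set ℝ) {m n : ℕ} (r p : ℕ)
    (a L τ δ : Fin m → Fin n → ℝ → ℝ)
    (B C : Fin m → Fin n → Fin m → Fin n → ℝ → ℝ)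
    (f g : ℝ → ℝ) (x : ℝ → Fin m → Fin n → ℝ) : Prop :=
  ∀ t ∈ T, ∀ (i : Fin m) (j : Fin n),
    HasDeltaDerivAt T (fun s => x s i j)
      (-(a i j t) * x t i j
        - (∑ c ∈ nbhd r i j,
            B i j c.1 c.2 t * f (x (t - τ c.1 c.2 t) c.1 c.2) * x t i j)
        - (∑ c ∈ nbhd p i j,
            C i j c.1 c.2 t
              * deltaIntegral T (fun u => g (x u c.1 c.2)) (t - δ c.1 c.2 t) t * x t i j)
        + L i j t) t

lemma floorPt_mem {T : Set ℝ} (hT : IsClosed T) {s : ℝ} (hs : (T ∩ Iic s).Nonempty) :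
    floorPt T s ∈ T ∩ Iic s :=
  (hT.inter isClosed_Iic).csSup_mem hs ⟨s, fun _ h => h.2⟩

lemma measurableSet_span (T : Set ℝ) : MeasurableSet (span T) := by
  apply Set.OrdConnected.measurableSet
  refine ⟨fun x hx y hy z hz => ⟨?_, ?_⟩⟩
  · obtain ⟨u, hu, hux⟩ := hx.1
    exact ⟨u, hu, le_trans hux hz.1⟩
  · obtain ⟨u, hu, huy⟩ := hy.2
    exact ⟨u, hu, lt_of_le_of_lt hz.2 huy⟩

lemma aemeasurable_floorPt (T : Set ℝ) :
    AEMeasurable (floorPt T) ((volume : Measure ℝ).restrict (span T)) := by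
  apply aemeasurable_restrict_of_monotoneOn (measurableSet_span T)
  intro x hx y _ hxy
  exact csSup_le_csSup ⟨y, fun _ h => h.2⟩ hx.1
    (inter_subset_inter_right T (Iic_subset_Iic.2 hxy))

/-- The delta measure gives the half-open interval `[a, b)` of `T` its length. -/
lemma deltaMeasure_Ico {T : Set ℝ} (hT : IsClosed T) {a b : ℝ} (ha : a ∈ T) (hb : b ∈ T) :
    deltaMeasure T (Ico a b) = ENNReal.ofReal (b - a) := by
  rw [deltaMeasure, Measure.map_apply_of_aemeasurable (aemeasurable_floorPt T) measurableSet_Ico,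
    Measure.restrict_apply' (measurableSet_span T), ← Real.volume_Ico]
  congr 1
  ext s
  constructor
  · rintro ⟨⟨h1, h2⟩, h3, _⟩
    refine ⟨h1.trans (floorPt_mem hT h3).2, ?_⟩
    by_contra hsb
    exact absurd (le_csSup (⟨s, fun _ h => h.2⟩ : BddAbove (T ∩ Iic s)) ⟨hb, not_lt.1 hsb⟩)
      (not_le.2 h2)
  · rintro ⟨h1, h2⟩
    have h3 : (T ∩ Iic s).Nonempty := ⟨a, ha, h1⟩
    exact ⟨⟨le_csSup ⟨s, fun _ h => h.2⟩ ⟨ha, h1⟩, lt_of_le_of_lt (floorPt_mem hT h3).2 h2⟩,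
      h3, ⟨b, hb, h2⟩⟩

end TimeScale

end

noncomputable section

namespace TimeScale

/-! Write the network as x^Δ = -a x + F(x). The proof inverts a constant-rate equation instead of
using the time-scale exponential of the variable rates a. Fix c > 0. For bounded w on T, continuous
at right-dense points, the average X(t) = ∫_0^∞ c e^{-cv} w(floor(t - v)) dv satisfies X^Δ = κ(μ)(w
- X) on T, where κ(μ) = (1 - e^{-cμ})/μ is `decayRate c μ` (`hasDeltaDerivAt_expAvg`). Hence a state
x bounded by ρ solves the network exactly when it is the average of its target x + (-a x +
F(x))/κ(μ). For the "only if", the difference d of x and that average satisfies d^Δ = -κ(μ) d, so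
e^{ct} d is constant on T; letting t → -∞ gives d = 0 (`eq_zero_of_hasDeltaDerivAt`).

The weight c e^{-cv} has mass one, so averaging does not increase suprema, and it suffices that the
target contracts the ρ-ball pointwise. The strict inequalities on ρ give q < 1 such that F is
bounded by q (inf a) ρ and has Lipschitz constant q (inf a) there. Then x + (-a x + e)/κ contracts
as soon as κ stays above a(1 + q)/2 by a fixed factor (`abs_step_le`), and since a is bounded and μ
a < 1, a large c achieves this (`mul_le_decayRate`).

For almost automorphy, an empty core makes the translation condition vacuous. Otherwise T is a
translate of a subgroup of ℝ and every shift is a period (`add_mem_of_core_nonempty`), so floor and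
graininess commute with the shifts. Along a subsequence on which the finitely many coefficients
recur, recurrence passes through averages by dominated convergence and through delays because
averages are Lipschitz. These properties define a closed set of bounded functions that averaging the
target maps to itself, and Banach's theorem applies there (`exists_fixedPoint`). -/

/-- A closed set of reals that is unbounded in both directions. -/
structure IsTwoSided (T : Set ℝ) : Prop where
  closed : IsClosed T
  below : ∀ s, (T ∩ Iic s).Nonempty
  above : ∀ s, (T ∩ Ioi s).Nonempty

lemma exists_near_of_translationNumber {T : Set ℝ} {τ t : ℝ} (hτ : τ ∈ translationNumbers T 1)
    (ht : t ∈ T) : ∃ u ∈ T, u + τ ∈ T ∧ |t - u| < 1 := by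
  obtain ⟨u, hu, h⟩ := Metric.exists_edist_lt_of_hausdorffEDist_lt ht hτ.2
  rw [edist_dist, ENNReal.ofReal_lt_ofReal_iff one_pos, Real.dist_eq] at h
  exact ⟨u, hu.1, hu.2, h⟩

/-- Translation numbers exist arbitrarily far in both directions, and each carries some point of T
close to a fixed one to another point of T. -/
lemma IsAlmostPeriodic.isTwoSided {T : Set ℝ} (hT : IsAlmostPeriodic T) : IsTwoSided T := by
  obtain ⟨⟨⟨t, ht⟩, hc⟩, h⟩ := hT
  obtain ⟨l, hl, h⟩ := h 1 one_pos
  refine ⟨hc, fun s => ?_, fun s => ?_⟩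
  · obtain ⟨τ, hτ, h1⟩ := h (s - t - 1 - l)
    obtain ⟨u, -, hu, h2⟩ := exists_near_of_translationNumber h1 ht
    rw [abs_lt] at h2
    exact ⟨_, hu, by simp only [mem_Iic]; linarith [hτ.2]⟩
  · obtain ⟨τ, hτ, h1⟩ := h (s - t + 1)
    obtain ⟨u, -, hu, h2⟩ := exists_near_of_translationNumber h1 ht
    rw [abs_lt] at h2
    exact ⟨_, hu, by simp only [mem_Ioi]; linarith [hτ.1]⟩

/-! ### Floor point, forward jump and graininess -/

namespace IsTwoSided

lemma floorPt_mem {T : Set ℝ} (hT : IsTwoSided T) (s : ℝ) : floorPt T s ∈ T :=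
  (TimeScale.floorPt_mem hT.closed (hT.below s)).1

lemma floorPt_le {T : Set ℝ} (hT : IsTwoSided T) (s : ℝ) : floorPt T s ≤ s :=
  (TimeScale.floorPt_mem hT.closed (hT.below s)).2

lemma _root_.TimeScale.le_floorPt {T : Set ℝ} {t s : ℝ} (ht : t ∈ T) (hts : t ≤ s) :
    t ≤ floorPt T s :=
  le_csSup ⟨s, fun _ h => h.2⟩ ⟨ht, hts⟩

lemma floorPt_self {T : Set ℝ} (hT : IsTwoSided T) {t : ℝ} (ht : t ∈ T) : floorPt T t = t :=
  le_antisymm (hT.floorPt_le t) (le_floorPt ht le_rfl)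

lemma monotone_floorPt {T : Set ℝ} (hT : IsTwoSided T) : Monotone (floorPt T) := fun x _ hxy =>
  le_floorPt (hT.floorPt_mem x) ((hT.floorPt_le x).trans hxy)

lemma measurable_floorPt {T : Set ℝ} (hT : IsTwoSided T) : Measurable (floorPt T) :=
  hT.monotone_floorPt.measurable

lemma floorPt_mem_Ico {T : Set ℝ} (hT : IsTwoSided T) {a b s : ℝ} (ha : a ∈ T) (hs : s ∈ Ico a b) :
    floorPt T s ∈ Ico a b :=
  ⟨le_floorPt ha hs.1, (hT.floorPt_le s).trans_lt hs.2⟩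

lemma sigma_mem_Ici {T : Set ℝ} (hT : IsTwoSided T) (t : ℝ) : sigma T t ∈ T ∩ Ici t := by
  rw [sigma, if_pos (hT.above t)]
  have hb : BddBelow (T ∩ Ioi t) := ⟨t, fun _ h => le_of_lt h.2⟩
  exact closure_minimal (s := T ∩ Ioi t) (inter_subset_inter_right T Ioi_subset_Ici_self)
    (hT.closed.inter isClosed_Ici) (csInf_mem_closure (hT.above t) hb)

lemma sigma_mem {T : Set ℝ} (hT : IsTwoSided T) (t : ℝ) : sigma T t ∈ T := (hT.sigma_mem_Ici t).1

lemma le_sigma {T : Set ℝ} (hT : IsTwoSided T) (t : ℝ) : t ≤ sigma T t := (hT.sigma_mem_Ici t).2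

lemma sigma_le {T : Set ℝ} (hT : IsTwoSided T) {t s : ℝ} (hs : s ∈ T) (hts : t < s) :
    sigma T t ≤ s := by
  rw [sigma, if_pos (hT.above t)]
  exact csInf_le ⟨t, fun _ h => le_of_lt h.2⟩ ⟨hs, hts⟩

lemma sigma_eq_self_iff {T : Set ℝ} (hT : IsTwoSided T) {t : ℝ} :
    sigma T t = t ↔ ∀ u > t, ∃ s ∈ T, s ∈ Ioo t u := by
  constructor
  · intro h u hu
    have h2 : sInf (T ∩ Ioi t) < u := by
      rw [sigma, if_pos (hT.above t)] at h
      rwa [h]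
    obtain ⟨s, hs, hsu⟩ := exists_lt_of_csInf_lt (hT.above t) h2
    exact ⟨s, hs.1, hs.2, hsu⟩
  · intro h
    refine le_antisymm (le_of_forall_gt fun u hu => ?_) (hT.le_sigma t)
    obtain ⟨s, hs, h1, h2⟩ := h u hu
    exact (hT.sigma_le hs h1).trans_lt h2

lemma floorPt_eq_of_mem_Ico {T : Set ℝ} (hT : IsTwoSided T) {t s : ℝ} (ht : t ∈ T)
    (hs : s ∈ Ico t (sigma T t)) : floorPt T s = t := by
  refine le_antisymm (not_lt.1 fun h => ?_) (le_floorPt ht hs.1)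
  exact absurd ((hT.sigma_le (hT.floorPt_mem s) h).trans (hT.floorPt_le s)) (not_le.2 hs.2)

lemma graininess_nonneg {T : Set ℝ} (hT : IsTwoSided T) (t : ℝ) : 0 ≤ graininess T t :=
  sub_nonneg.2 (hT.le_sigma t)

/-- At points of the time scale the floor function is continuous from the right. -/
lemma tendsto_floorPt_Ici {T : Set ℝ} (hT : IsTwoSided T) {t : ℝ} (ht : t ∈ T) :
    Tendsto (floorPt T) (𝓝[≥] t) (𝓝[T] t) := by
  refine tendsto_nhdsWithin_iff.2 ⟨?_, Eventually.of_forall hT.floorPt_mem⟩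
  refine tendsto_of_tendsto_of_tendsto_of_le_of_le' tendsto_const_nhds
    (tendsto_id.mono_left (nhdsWithin_le_nhds (s := Ici t))) ?_ ?_
  · filter_upwards [self_mem_nhdsWithin] with s hs using le_floorPt ht hs
  · exact Eventually.of_forall hT.floorPt_le

/-- For s < t the jump σ(s) cannot pass t, and for s to the left of a point u ∈ T just beyond t it
cannot pass u; so the graininess is small near a right-dense t. -/
lemma continuousWithinAt_graininess {T : Set ℝ} (hT : IsTwoSided T) {t : ℝ} (ht : sigma T t = t) :
    ContinuousWithinAt (graininess T) T t := by
  have h0 : graininess T t = 0 := by simp [graininess, ht]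
  rw [ContinuousWithinAt, h0, Metric.tendsto_nhds]
  intro ε hε
  obtain ⟨u, hu, htu, hue⟩ := hT.sigma_eq_self_iff.1 ht (t + ε) (by linarith)
  filter_upwards [self_mem_nhdsWithin, mem_nhdsWithin_of_mem_nhds (Ioo_mem_nhds
    (show t - ε < t by linarith) htu)] with s hs hs2
  rw [Real.dist_eq, sub_zero, abs_of_nonneg (hT.graininess_nonneg s), graininess]
  rcases lt_or_ge s t with h | h
  · have := hT.sigma_le (t := s) (s := t) (ht ▸ hT.sigma_mem t) h
    linarith [hs2.1]
  · have := hT.sigma_le hu hs2.2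
    linarith

end IsTwoSided

/-! ### Measurability along the floor function -/

/-- Sampling at the next point of the grid of mesh 1/(n + 1) gives functions that factor through ℤ.
The sample point lies strictly to the right of x, so right continuity gives pointwise convergence.
-/
lemma measurable_of_continuousWithinAt_Ioi {f : ℝ → ℝ}
    (hf : ∀ x, ContinuousWithinAt f (Ioi x) x) : Measurable f := by
  have hy : ∀ (n : ℕ) (x : ℝ), x < (⌊(n + 1 : ℝ) * x⌋ + 1 : ℝ) / (n + 1) ∧
      (⌊(n + 1 : ℝ) * x⌋ + 1 : ℝ) / (n + 1) ≤ x + 1 / (n + 1) := by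
    intro n x
    have hn : (0 : ℝ) < n + 1 := by positivity
    constructor
    · rw [lt_div_iff₀ hn, mul_comm]
      exact Int.lt_floor_add_one _
    · rw [div_le_iff₀ hn, add_mul x, one_div_mul_cancel hn.ne', mul_comm x]
      linarith [Int.floor_le ((n + 1 : ℝ) * x)]
  refine measurable_of_tendsto_metrizable
    (f := fun (n : ℕ) x => f ((⌊(n + 1 : ℝ) * x⌋ + 1 : ℝ) / (n + 1))) (fun n => ?_)
    (tendsto_pi_nhds.2 fun x => ?_)
  · exact (measurable_from_top (f := fun k : ℤ => f ((k + 1 : ℝ) / (n + 1)))).comp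
      (Int.measurable_floor.comp (measurable_const_mul _))
  · refine (hf x).tendsto.comp (tendsto_nhdsWithin_iff.2
      ⟨?_, Eventually.of_forall fun n => (hy n x).1⟩)
    refine tendsto_of_tendsto_of_tendsto_of_le_of_le tendsto_const_nhds ?_
      (fun n => (hy n x).1.le) (fun n => (hy n x).2)
    simpa using tendsto_const_nhds.add (tendsto_one_div_add_atTop_nhds_zero_nat (𝕜 := ℝ))

/-- Continuity at the right-dense points, the part of rd-continuity that controls integrals. -/
def RightDenseCont (T : Set ℝ) (h : ℝ → ℝ) : Prop :=
  ∀ t ∈ T, sigma T t = t → ContinuousWithinAt h T t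

lemma RdContinuous.rightDenseCont {T : Set ℝ} (hT : IsTwoSided T) {h : ℝ → ℝ}
    (hh : RdContinuous T h) : RightDenseCont T h :=
  fun t ht hs => hh.1 t ⟨ht, hT.above t, hs⟩

/-- The composition is right continuous everywhere: it is constant to the right of x inside a gap,
and otherwise x is a right-dense point of T. -/
lemma RightDenseCont.measurable_comp_floorPt {T : Set ℝ} (hT : IsTwoSided T) {h : ℝ → ℝ}
    (hh : RightDenseCont T h) : Measurable fun s => h (floorPt T s) := by
  refine measurable_of_continuousWithinAt_Ioi fun x => ?_
  rcases lt_or_ge x (sigma T (floorPt T x)) with hx | hx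
  · refine (continuousWithinAt_const (b := h (floorPt T x))).congr_of_eventuallyEq ?_ rfl
    filter_upwards [Ioo_mem_nhdsGT hx] with s hs
    rw [hT.floorPt_eq_of_mem_Ico (hT.floorPt_mem x) ⟨(hT.floorPt_le x).trans hs.1.le, hs.2⟩]
  · have h1 : floorPt T x = x := by
      have := le_floorPt (hT.sigma_mem _) hx
      have h2 := hT.le_sigma (floorPt T x)
      have h3 : sigma T (floorPt T x) = floorPt T x := le_antisymm this h2
      refine le_antisymm (hT.floorPt_le x) (not_lt.1 fun hlt => ?_)
      obtain ⟨s, hs, hs1, hs2⟩ := hT.sigma_eq_self_iff.1 h3 x hlt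
      exact absurd (le_floorPt hs hs2.le) (not_le.2 hs1)
    have hxT : x ∈ T := h1 ▸ hT.floorPt_mem x
    have hsx : sigma T x = x := le_antisymm (by rwa [h1] at hx) (hT.le_sigma x)
    have := (hh x hxT hsx).tendsto.comp ((hT.tendsto_floorPt_Ici hxT).mono_left
      (nhdsWithin_mono x Ioi_subset_Ici_self))
    simpa [ContinuousWithinAt, Function.comp_def, h1] using this

/-! ### The delta derivative at right-dense and right-scattered points -/

lemma hasDeltaDerivAt_iff_of_sigma_eq {T : Set ℝ} {f : ℝ → ℝ} {d t : ℝ} (hs : sigma T t = t) :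
    HasDeltaDerivAt T f d t ↔ HasDerivWithinAt f d T t := by
  rw [hasDerivWithinAt_iff_isLittleO, Asymptotics.isLittleO_iff, HasDeltaDerivAt, hs]
  refine forall_congr' fun ε => forall_congr' fun _ => eventually_congr
    (Eventually.of_forall fun s => ?_)
  rw [Real.norm_eq_abs, Real.norm_eq_abs, abs_sub_comm t s, smul_eq_mul,
    ← abs_neg (f t - f s - d * (t - s))]
  ring_nf

lemma hasDeltaDerivAt_iff_of_lt_sigma {T : Set ℝ} {f : ℝ → ℝ} {d t : ℝ} (ht : t ∈ T)
    (hs : t < sigma T t) :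
    HasDeltaDerivAt T f d t ↔
      ContinuousWithinAt f T t ∧ f (sigma T t) - f t = d * graininess T t := by
  have hμ : 0 < sigma T t - t := sub_pos.2 hs
  have hid : Tendsto (fun s : ℝ => s) (𝓝[T] t) (𝓝 t) := tendsto_id.mono_left nhdsWithin_le_nhds
  constructor
  · intro h
    have heq : f (sigma T t) - f t = d * graininess T t := by
      -- Putting s = t in the definition makes the error at most any given ε.
      refine sub_eq_zero.1 (abs_eq_zero.1 (le_antisymm (le_of_forall_pos_le_add fun ε hε => ?_)
        (abs_nonneg _)))
      have h1 := (h (ε / (sigma T t - t)) (div_pos hε hμ)).self_of_nhdsWithin ht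
      rw [abs_of_pos hμ, div_mul_cancel₀ _ hμ.ne'] at h1
      rw [graininess]
      linarith
    refine ⟨?_, heq⟩
    rw [ContinuousWithinAt, Metric.tendsto_nhds]
    intro ε hε
    have h2 : Tendsto (fun s => ε / (2 * (sigma T t - t)) * |sigma T t - s| + |d| * |s - t|)
        (𝓝[T] t) (𝓝 (ε / (2 * (sigma T t - t)) * |sigma T t - t| + |d| * |t - t|)) :=
      ((hid.const_sub _).abs.const_mul _).add ((hid.sub_const _).abs.const_mul _)
    have h3 : ε / (2 * (sigma T t - t)) * |sigma T t - t| + |d| * |t - t| < ε := by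
      rw [abs_of_pos hμ, sub_self, abs_zero, mul_zero, add_zero]
      have : ε / (2 * (sigma T t - t)) * (sigma T t - t) = ε / 2 := by
        field_simp
      linarith
    filter_upwards [h _ (div_pos hε (mul_pos two_pos hμ)), h2.eventually_lt_const h3] with s h4 h5
    rw [Real.dist_eq]
    have h6 : f s - f t = d * (s - t) - (f (sigma T t) - f s - d * (sigma T t - s)) := by
      rw [graininess] at heq
      linarith
    rw [h6]
    calc _ ≤ |d * (s - t)| + |f (sigma T t) - f s - d * (sigma T t - s)| := abs_sub _ _
      _ < ε := by rw [abs_mul]; linarith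
  · rintro ⟨hc, heq⟩ ε hε
    have h1 : Tendsto (fun s => |f (sigma T t) - f s - d * (sigma T t - s)| -
        ε * |sigma T t - s|) (𝓝[T] t) (𝓝 (|f (sigma T t) - f t - d * (sigma T t - t)| -
        ε * |sigma T t - t|)) :=
      ((hc.tendsto.const_sub _).sub ((hid.const_sub _).const_mul _)).abs.sub
        ((hid.const_sub _).abs.const_mul _)
    have h2 : |f (sigma T t) - f t - d * (sigma T t - t)| - ε * |sigma T t - t| < 0 := by
      rw [heq, graininess, sub_self, abs_zero, abs_of_pos hμ]
      nlinarith
    filter_upwards [h1.eventually_lt_const h2] with s hs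
    linarith

lemma HasDeltaDerivAt.continuousWithinAt {T : Set ℝ} (hT : IsTwoSided T) {f : ℝ → ℝ} {d t : ℝ}
    (ht : t ∈ T) (h : HasDeltaDerivAt T f d t) : ContinuousWithinAt f T t := by
  rcases (hT.le_sigma t).eq_or_lt with hs | hs
  · exact ((hasDeltaDerivAt_iff_of_sigma_eq hs.symm).1 h).continuousWithinAt
  · exact ((hasDeltaDerivAt_iff_of_lt_sigma ht hs).1 h).1

/-- A function with vanishing delta derivative is constant on the time scale. -/
lemma eq_of_hasDeltaDerivAt_zero {T : Set ℝ} (hT : IsTwoSided T) {q : ℝ → ℝ}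
    (hq : ∀ t ∈ T, HasDeltaDerivAt T q 0 t) {a b : ℝ} (ha : a ∈ T) (hb : b ∈ T) :
    q a = q b := by
  wlog hab : a ≤ b generalizing a b
  · exact (this hb ha (le_of_not_ge hab)).symm
  have hcont : ContinuousOn q T := fun t ht => (hq t ht).continuousWithinAt hT ht
  suffices h : ∀ ε > 0, |q b - q a| ≤ ε * (b - a) by
    have h1 : Tendsto (fun ε : ℝ => ε * (b - a)) (𝓝[>] 0) (𝓝 (0 * (b - a))) :=
      (tendsto_id.mul_const _).mono_left nhdsWithin_le_nhds
    rw [zero_mul] at h1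
    have h2 : |q b - q a| ≤ 0 := ge_of_tendsto h1 (by
      filter_upwards [self_mem_nhdsWithin] with ε hε using h ε hε)
    exact (sub_eq_zero.1 (abs_nonpos_iff.1 h2)).symm
  intro ε hε
  -- Induction along T: S is closed, and its supremum c can be exceeded whenever c < b, by a nearby
  -- point if c is right-dense and by σ(c) otherwise.
  set S : Set ℝ := {t | t ∈ T ∩ Icc a b ∧ |q t - q a| ≤ ε * (t - a)} with hS
  have hclosed : IsClosed S := by
    have hF : ContinuousOn (fun t => |q t - q a| - ε * (t - a)) (T ∩ Icc a b) :=
      ((hcont.mono inter_subset_left).sub continuousOn_const).abs.sub (by fun_prop)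
    have := hF.preimage_isClosed_of_isClosed
      (hT.closed.inter isClosed_Icc) isClosed_Iic (t := Iic 0)
    convert this using 1
    ext t
    simp [hS]
  have haS : a ∈ S := ⟨⟨ha, left_mem_Icc.2 hab⟩, by simp⟩
  have hbdd : BddAbove S := ⟨b, fun t ht => ht.1.2.2⟩
  have hc := hclosed.csSup_mem ⟨a, haS⟩ hbdd
  set c := sSup S
  have hstep : ∀ s ∈ T, c < s → s ≤ b → |q s - q c| ≤ ε * (s - c) → False := by
    intro s hsT hcs hsb h
    have : s ∈ S := by
      refine ⟨⟨hsT, hc.1.2.1.trans hcs.le, hsb⟩, ?_⟩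
      calc |q s - q a| ≤ |q s - q c| + |q c - q a| := abs_sub_le _ _ _
        _ ≤ ε * (s - a) := by linarith [hc.2]
    exact absurd (le_csSup hbdd this) (not_le.2 hcs)
  rcases hc.1.2.2.eq_or_lt with hcb | hcb
  · rw [← hcb]; exact hc.2
  exfalso
  rcases (hT.le_sigma c).eq_or_lt with hs | hs
  · have h1 := hq c hc.1.1 ε hε
    obtain ⟨η, hη, h2⟩ := Metric.eventually_nhds_iff.1 (eventually_nhdsWithin_iff.1 h1)
    obtain ⟨s, hsT, hcs, hsu⟩ := hT.sigma_eq_self_iff.1 hs.symm (min b (c + η))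
      (lt_min hcb (by linarith))
    refine hstep s hsT hcs (hsu.le.trans (min_le_left _ _)) ?_
    have h3 := h2 (y := s) (by
      rw [Real.dist_eq, abs_of_pos (sub_pos.2 hcs)]
      linarith [hsu.trans_le (min_le_right _ _)]) hsT
    rwa [← hs, zero_mul, sub_zero, abs_sub_comm, abs_sub_comm c s,
      abs_of_pos (sub_pos.2 hcs)] at h3
  · have h1 := ((hasDeltaDerivAt_iff_of_lt_sigma hc.1.1 hs).1 (hq c hc.1.1)).2
    refine hstep _ (hT.sigma_mem c) hs (hT.sigma_le hb hcb) ?_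
    rw [h1, zero_mul, abs_zero]
    exact mul_nonneg hε.le (sub_nonneg.2 hs.le)

/-! ### The delta integral -/

/-- The delta integral as a Lebesgue integral along the floor function. -/
lemma deltaIntegral_eq {T : Set ℝ} (hT : IsTwoSided T) {h : ℝ → ℝ}
    (hm : Measurable fun s => h (floorPt T s)) {a b : ℝ} (ha : a ∈ T) (hb : b ∈ T) :
    deltaIntegral T h a b = ∫ s in a..b, h (floorPt T s) := by
  have hspan : span T = univ := eq_univ_of_forall fun s => ⟨hT.below s, hT.above s⟩
  have hdm : deltaMeasure T = Measure.map (floorPt T) volume := by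
    rw [deltaMeasure, hspan, Measure.restrict_univ]
  -- The values of `h` off T are arbitrary, so `h` need not be measurable; the delta measure lives
  -- on T, where `h` agrees with its floor extension.
  have hae : h =ᵐ[deltaMeasure T] fun s => h (floorPt T s) := by
    have hmem : ∀ᵐ u ∂(deltaMeasure T), u ∈ T := by
      rw [hdm]
      exact (ae_map_iff hT.measurable_floorPt.aemeasurable hT.closed.measurableSet).2
        (Eventually.of_forall hT.floorPt_mem)
    filter_upwards [hmem] with u hu
    rw [hT.floorPt_self hu]
  have key : ∀ x ∈ T, ∀ y ∈ T, ∫ u in Ico x y, h u ∂(deltaMeasure T) =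
      ∫ s in Ioc x y, h (floorPt T s) := by
    intro x hx y hy
    have hpre : floorPt T ⁻¹' Ico x y = Ico x y := by
      ext s
      refine ⟨fun hs => ⟨hs.1.trans (hT.floorPt_le s), not_le.1 fun hle => ?_⟩,
        hT.floorPt_mem_Ico hx⟩
      exact absurd (le_floorPt hy hle) (not_le.2 hs.2)
    rw [integral_congr_ae (ae_restrict_of_ae hae), hdm,
      setIntegral_map measurableSet_Ico hm.aestronglyMeasurable
        hT.measurable_floorPt.aemeasurable, hpre, integral_Ico_eq_integral_Ioc]
    simp only [hT.floorPt_self (hT.floorPt_mem _)]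
  rw [deltaIntegral, key a ha b hb, key b hb a ha, intervalIntegral]

/-! ### Exponential averages on the line -/

/-- The exponentially weighted average of `w` over the past of `t`. -/
def expAvg (c : ℝ) (w : ℝ → ℝ) (t : ℝ) : ℝ := ∫ v in Ioi (0 : ℝ), c * Real.exp (-c * v) * w (t - v)

lemma integrableOn_expWeight {c : ℝ} (hc : 0 < c) :
    IntegrableOn (fun v => c * Real.exp (-c * v)) (Ioi 0) :=
  (integrableOn_exp_mul_Ioi (neg_lt_zero.2 hc) 0).const_mul c

lemma integral_expWeight {c : ℝ} (hc : 0 < c) :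
    ∫ v in Ioi (0 : ℝ), c * Real.exp (-c * v) = 1 := by
  rw [integral_const_mul, integral_exp_mul_Ioi (neg_lt_zero.2 hc)]
  simp [hc.ne']

lemma integrableOn_expAvg {c M : ℝ} (hc : 0 < c) {w : ℝ → ℝ} (hw : Measurable w)
    (hM : ∀ s, |w s| ≤ M) (t : ℝ) :
    IntegrableOn (fun v => c * Real.exp (-c * v) * w (t - v)) (Ioi 0) :=
  Integrable.mul_bdd (c := M) (g := fun v => w (t - v)) (integrableOn_expWeight hc)
    (hw.comp (measurable_const.sub measurable_id)).aestronglyMeasurable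
    (Eventually.of_forall fun v => hM (t - v))

lemma abs_expAvg_le {c M : ℝ} (hc : 0 < c) {w : ℝ → ℝ} (hM : ∀ s, |w s| ≤ M) (t : ℝ) :
    |expAvg c w t| ≤ M := by
  rw [expAvg]
  calc |∫ v in Ioi (0 : ℝ), c * Real.exp (-c * v) * w (t - v)|
      ≤ ∫ v in Ioi (0 : ℝ), c * Real.exp (-c * v) * M := by
        rw [← Real.norm_eq_abs]
        refine norm_integral_le_of_norm_le ((integrableOn_expWeight hc).mul_const M)
          (Eventually.of_forall fun v => ?_)
        rw [Real.norm_eq_abs, abs_mul, abs_of_nonneg (by positivity)]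
        gcongr
        exact hM _
    _ = M := by rw [integral_mul_const, integral_expWeight hc, one_mul]

lemma expAvg_sub {c M M' : ℝ} (hc : 0 < c) {w w' : ℝ → ℝ} (hw : Measurable w) (hw' : Measurable w')
    (hM : ∀ s, |w s| ≤ M) (hM' : ∀ s, |w' s| ≤ M') (t : ℝ) :
    expAvg c w t - expAvg c w' t = expAvg c (fun s => w s - w' s) t := by
  rw [expAvg, expAvg, expAvg, ← integral_sub (integrableOn_expAvg hc hw hM t)
    (integrableOn_expAvg hc hw' hM' t)]
  simp only [mul_sub]

/-- Dominated convergence. The evaluation points `t k` may be unbounded, as they are for t + s_k: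
only the integrands at a fixed lag v have to converge. -/
lemma tendsto_expAvg {c M : ℝ} (hc : 0 < c) {w : ℕ → ℝ → ℝ} {w' : ℝ → ℝ} {t : ℕ → ℝ} {t' : ℝ}
    (hw : ∀ k, Measurable (w k)) (hM : ∀ k s, |w k s| ≤ M)
    (h : ∀ v, Tendsto (fun k => w k (t k - v)) atTop (𝓝 (w' (t' - v)))) :
    Tendsto (fun k => expAvg c (w k) (t k)) atTop (𝓝 (expAvg c w' t')) := by
  refine tendsto_integral_of_dominated_convergence (fun v => c * Real.exp (-c * v) * M)
    (fun k => (integrableOn_expAvg hc (hw k) (hM k) (t k)).aestronglyMeasurable)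
    ((integrableOn_expWeight hc).mul_const M) (fun k => Eventually.of_forall fun v => ?_)
    (Eventually.of_forall fun v => (h v).const_mul _)
  rw [Real.norm_eq_abs, abs_mul, abs_of_nonneg (by positivity)]
  gcongr
  exact hM _ _

lemma expAvg_eq {c : ℝ} (w : ℝ → ℝ) (t : ℝ) :
    expAvg c w t = Real.exp (-c * t) * ∫ s in Iic t, c * Real.exp (c * s) * w s := by
  have h := (volume.measurePreserving_sub_left t).setIntegral_preimage_emb
    (MeasurableEquiv.subLeft t).measurableEmbedding
    (fun s => Real.exp (-c * t) * (c * Real.exp (c * s) * w s)) (Iic t)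
  rw [← integral_const_mul, ← h, expAvg, ← integral_Ici_eq_integral_Ioi]
  have hpre : (fun v => t - v) ⁻¹' Iic t = Ici 0 := by
    ext v; simp
  rw [hpre]
  refine integral_congr_ae (Eventually.of_forall fun v => ?_)
  simp only
  rw [show -c * v = -c * t + c * (t - v) by ring, Real.exp_add]
  ring

lemma integrableOn_exp_mul_Iic_of_bdd {c M : ℝ} (hc : 0 < c) {w : ℝ → ℝ} (hw : Measurable w)
    (hM : ∀ s, |w s| ≤ M) (t : ℝ) :
    IntegrableOn (fun s => c * Real.exp (c * s) * w s) (Iic t) :=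
  Integrable.mul_bdd (c := M) ((integrableOn_exp_mul_Iic hc t).const_mul c) hw.aestronglyMeasurable
    (Eventually.of_forall hM)

lemma exp_mul_expAvg_sub {c M : ℝ} (hc : 0 < c) {w : ℝ → ℝ} (hw : Measurable w)
    (hM : ∀ s, |w s| ≤ M) (a b : ℝ) :
    Real.exp (c * b) * expAvg c w b - Real.exp (c * a) * expAvg c w a =
      ∫ s in a..b, c * Real.exp (c * s) * w s := by
  rw [expAvg_eq, expAvg_eq, ← mul_assoc, ← mul_assoc, ← Real.exp_add, ← Real.exp_add]
  simp only [neg_mul, add_neg_cancel, Real.exp_zero, one_mul]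
  exact intervalIntegral.integral_Iic_sub_Iic (integrableOn_exp_mul_Iic_of_bdd hc hw hM a)
    (integrableOn_exp_mul_Iic_of_bdd hc hw hM b)

lemma integral_mul_exp (c a b : ℝ) :
    ∫ s in a..b, c * Real.exp (c * s) = Real.exp (c * b) - Real.exp (c * a) := by
  refine intervalIntegral.integral_eq_sub_of_hasDerivAt (f := fun s => Real.exp (c * s))
    (fun s _ => ?_) (Continuous.intervalIntegrable (by fun_prop) _ _)
  simpa [mul_comm] using ((hasDerivAt_id s).const_mul c).exp

/-- With X the average, e^{cb}(X(b) - X(a)) is the integral of c e^{cs} w over [a, b] minus (e^{cb}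
- e^{ca}) X(a). Each term is at most M (e^{cb} - e^{ca}) ≤ e^{cb} M c (b - a), whence the factor 2.
-/
lemma abs_expAvg_sub_le {c M : ℝ} (hc : 0 < c) {w : ℝ → ℝ} (hw : Measurable w)
    (hM : ∀ s, |w s| ≤ M) (a b : ℝ) :
    |expAvg c w b - expAvg c w a| ≤ 2 * M * c * |b - a| := by
  wlog hab : a ≤ b generalizing a b
  · rw [abs_sub_comm, abs_sub_comm b]
    exact this b a (le_of_not_ge hab)
  have hM0 : 0 ≤ M := (abs_nonneg _).trans (hM 0)
  have h1 := exp_mul_expAvg_sub hc hw hM a b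
  have h2 : |∫ s in a..b, c * Real.exp (c * s) * w s| ≤
      (Real.exp (c * b) - Real.exp (c * a)) * M := by
    rw [← integral_mul_exp, ← intervalIntegral.integral_mul_const, ← Real.norm_eq_abs]
    have hcont : Continuous fun s => c * Real.exp (c * s) * M := by fun_prop
    refine intervalIntegral.norm_integral_le_of_norm_le (μ := volume) hab
      (Eventually.of_forall fun s _ => ?_) (hcont.intervalIntegrable _ _)
    rw [Real.norm_eq_abs, abs_mul, abs_of_nonneg (by positivity)]
    gcongr
    exact hM _
  set e := Real.exp (-(c * (b - a))) with he
  have hab' : Real.exp (c * a) = Real.exp (c * b) * e := by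
    rw [he, ← Real.exp_add]; ring_nf
  have hpos := Real.exp_pos (c * b)
  have h3 : Real.exp (c * b) * (expAvg c w b - expAvg c w a) =
      (∫ s in a..b, c * Real.exp (c * s) * w s) -
        Real.exp (c * b) * ((1 - e) * expAvg c w a) := by
    rw [← h1, hab']; ring
  have he1 : 1 - e ≤ c * (b - a) := by
    have := Real.add_one_le_exp (-(c * (b - a)))
    linarith
  have he0 : 0 ≤ 1 - e := by
    rw [sub_nonneg, he]
    exact Real.exp_le_one_iff.2 (neg_nonpos.2 (mul_nonneg hc.le (sub_nonneg.2 hab)))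
  have h4 : Real.exp (c * b) * |expAvg c w b - expAvg c w a| ≤
      Real.exp (c * b) * (2 * M * c * |b - a|) := by
    rw [← abs_of_pos hpos, ← abs_mul, abs_of_pos hpos, h3]
    calc _ ≤ |∫ s in a..b, c * Real.exp (c * s) * w s| +
          |Real.exp (c * b) * ((1 - e) * expAvg c w a)| := abs_sub _ _
      _ ≤ (Real.exp (c * b) - Real.exp (c * a)) * M + Real.exp (c * b) * ((1 - e) * M) := by
          rw [abs_mul (Real.exp _), abs_mul (1 - e), abs_of_pos hpos, abs_of_nonneg he0]
          gcongr
          exact abs_expAvg_le hc hM a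
      _ = Real.exp (c * b) * (2 * M * (1 - e)) := by rw [hab']; ring
      _ ≤ _ := by
          rw [abs_of_nonneg (sub_nonneg.2 hab), mul_assoc (2 * M)]
          gcongr
  exact le_of_mul_le_mul_left h4 hpos

/-! ### The decay rate of e^{-ct} on a time scale -/

/-- The coefficient `(1 - exp (-c μ)) / μ` of the time-scale decay `exp (-c t)`, equal to `c` at
`μ = 0`. -/
def decayRate (c : ℝ) (μ : ℝ) : ℝ := dslope (fun y => -Real.exp (-c * y)) 0 μ

lemma hasDerivAt_neg_exp (c y : ℝ) :
    HasDerivAt (fun y => -Real.exp (-c * y)) (c * Real.exp (-c * y)) y := by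
  have h := (((hasDerivAt_id y).const_mul (-c)).exp).neg
  simp only [mul_one, id] at h
  refine h.congr_deriv ?_
  ring

lemma decayRate_zero (c : ℝ) : decayRate c 0 = c := by
  rw [decayRate, dslope_same, (hasDerivAt_neg_exp c 0).deriv]
  simp

lemma mul_decayRate (c μ : ℝ) : μ * decayRate c μ = 1 - Real.exp (-c * μ) := by
  have := sub_smul_dslope (fun y => -Real.exp (-c * y)) 0 μ
  simp only [sub_zero, smul_eq_mul, mul_zero, Real.exp_zero] at this
  rw [decayRate, this]
  ring

lemma continuous_decayRate (c : ℝ) : Continuous (decayRate c) := by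
  rw [← continuousOn_univ]
  exact (continuousOn_dslope univ_mem).2 ⟨by fun_prop, (hasDerivAt_neg_exp c 0).differentiableAt⟩

lemma decayRate_le {c μ : ℝ} (hμ : 0 ≤ μ) : decayRate c μ ≤ c := by
  rcases hμ.eq_or_lt with rfl | h
  · rw [decayRate_zero]
  · refine le_of_mul_le_mul_left ?_ h
    rw [mul_decayRate]
    linarith [Real.add_one_le_exp (-c * μ)]

/-- Convexity of exp on [-c/K, 0] with weight μ a gives e^{-cμ} ≤ e^{-μ a c/K} ≤ 1 - μ a (1 -
e^{-c/K}). The bound is uniform in μ even if μ a comes arbitrarily close to 1, where κ ≥ a would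
fail. -/
lemma mul_le_decayRate {c K a μ : ℝ} (hc : 0 ≤ c) (hK : 0 < K) (ha : 0 ≤ a) (haK : a ≤ K)
    (hμ : 0 ≤ μ) (haμ : μ * a ≤ 1) : a * (1 - Real.exp (-(c / K))) ≤ decayRate c μ := by
  rcases hμ.eq_or_lt with rfl | h
  · rw [decayRate_zero]
    have h1 := Real.add_one_le_exp (-(c / K))
    calc a * (1 - Real.exp (-(c / K))) ≤ K * (c / K) :=
          mul_le_mul haK (by linarith) (sub_nonneg.2 (Real.exp_le_one_iff.2
            (neg_nonpos.2 (by positivity)))) hK.le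
      _ = c := by field_simp
  · refine le_of_mul_le_mul_left ?_ h
    rw [mul_decayRate]
    have hconv := convexOn_exp.2 (mem_univ 0) (mem_univ (-(c / K)))
      (sub_nonneg.2 haμ) (mul_nonneg hμ ha) (by ring)
    simp only [smul_eq_mul, mul_zero, zero_add, Real.exp_zero, mul_one] at hconv
    have : Real.exp (-c * μ) ≤ Real.exp (μ * a * -(c / K)) := by
      refine Real.exp_le_exp.2 ?_
      have : μ * a * (c / K) ≤ μ * K * (c / K) := by gcongr
      have h2 : μ * K * (c / K) = μ * c := by field_simp
      linarith
    linarith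

/-! ### Delta equations solved by exponential averages -/

section

variable {T : Set ℝ} {c M : ℝ} {w : ℝ → ℝ}

/-- The average along the floor function solves `x^Δ = decayRate c μ * (w - x)`. -/
lemma hasDeltaDerivAt_expAvg (hT : IsTwoSided T) (hc : 0 < c) (hw : RightDenseCont T w)
    (hM : ∀ t ∈ T, |w t| ≤ M) {t : ℝ} (ht : t ∈ T) :
    HasDeltaDerivAt T (expAvg c fun s => w (floorPt T s))
      (decayRate c (graininess T t) * (w t - expAvg c (fun s => w (floorPt T s)) t)) t := by
  have hm := hw.measurable_comp_floorPt hT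
  have hM' : ∀ s, |w (floorPt T s)| ≤ M := fun s => hM _ (hT.floorPt_mem s)
  set X := expAvg c fun s => w (floorPt T s) with hX
  have hXc : Continuous X := by
    refine continuous_iff_continuousAt.2 fun s => ?_
    refine tendsto_iff_dist_tendsto_zero.2 (squeeze_zero (fun _ => dist_nonneg)
      (fun u => abs_expAvg_sub_le hc hm hM' s u) ?_)
    have : Tendsto (fun u => 2 * M * c * |u - s|) (𝓝 s) (𝓝 (2 * M * c * |s - s|)) :=
      Continuous.tendsto (by fun_prop) s
    simpa using this
  rcases (hT.le_sigma t).eq_or_lt with hs | hs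
  · have hμ : graininess T t = 0 := by rw [graininess, ← hs, sub_self]
    rw [hasDeltaDerivAt_iff_of_sigma_eq hs.symm, hμ, decayRate_zero]
    have hI : HasDerivWithinAt (fun s => Real.exp (c * s) * X s) (c * Real.exp (c * t) * w t)
        T t := by
      rw [hasDerivWithinAt_iff_isLittleO, Asymptotics.isLittleO_iff]
      intro ε hε
      have hcw : ContinuousWithinAt w T t := hw t ht hs.symm
      -- Two independent variables: below, the exponential is evaluated at u and `w` at the floor of
      -- u.
      have hprod : Tendsto (fun p : ℝ × ℝ => c * Real.exp (c * p.1) * w p.2)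
          (𝓝 t ×ˢ 𝓝[T] t) (𝓝 (c * Real.exp (c * t) * w t)) := by
        have h1 : Continuous fun s => c * Real.exp (c * s) := by fun_prop
        exact ((h1.tendsto t).comp tendsto_fst).mul (hcw.tendsto.comp tendsto_snd)
      obtain ⟨P, hP, Q, hQ, hPQ⟩ := eventually_prod_iff.1
        (Metric.tendsto_nhds.1 hprod ε hε)
      obtain ⟨η, hη, hPη⟩ := Metric.eventually_nhds_iff.1
        (hP.and (eventually_nhdsWithin_iff.1 hQ))
      filter_upwards [self_mem_nhdsWithin, mem_nhdsWithin_of_mem_nhds (Metric.ball_mem_nhds t hη)]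
        with s hsT hsη
      have hint : ∀ x y, IntervalIntegrable (fun u => c * Real.exp (c * u) * w (floorPt T u))
          volume x y := fun x y => by
        refine ⟨?_, ?_⟩ <;> exact (integrableOn_exp_mul_Iic_of_bdd hc hm hM' _).mono_set
            (fun u hu => hu.2)
      have h1 : Real.exp (c * s) * X s - Real.exp (c * t) * X t -
          (s - t) • (c * Real.exp (c * t) * w t) =
          ∫ u in t..s, (c * Real.exp (c * u) * w (floorPt T u) - c * Real.exp (c * t) * w t) := by
        rw [intervalIntegral.integral_sub (hint _ _) intervalIntegrable_const,
          intervalIntegral.integral_const, hX, exp_mul_expAvg_sub hc hm hM']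
      rw [h1]
      refine intervalIntegral.norm_integral_le_of_norm_le_const fun u hu => ?_
      -- Both ends of the interval lie in T, so the floor of u cannot leave it.
      have hfl : floorPt T u ∈ uIcc t s := by
        rcases le_total t s with hts | hts
        · rw [uIoc_of_le hts] at hu
          rw [uIcc_of_le hts]
          exact ⟨le_floorPt ht hu.1.le, (hT.floorPt_le u).trans hu.2⟩
        · rw [uIoc_of_ge hts] at hu
          rw [uIcc_of_ge hts]
          exact ⟨le_floorPt hsT hu.1.le, (hT.floorPt_le u).trans hu.2⟩
      have hball : ∀ v ∈ uIcc t s, dist v t < η := fun v hv =>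
        (by simpa [Real.dist_eq] using abs_sub_left_of_mem_uIcc hv :
          dist v t ≤ dist s t).trans_lt hsη
      exact (hPQ (hPη (hball u (uIoc_subset_uIcc hu))).1
        ((hPη (hball _ hfl)).2 (hT.floorPt_mem u))).le
    have hE : HasDerivAt (fun s => Real.exp (-c * s)) (-c * Real.exp (-c * t)) t := by
      simpa [mul_comm] using ((hasDerivAt_id t).const_mul (-c)).exp
    have hprod := hE.hasDerivWithinAt.mul hI
    have hee : ∀ s, Real.exp (-c * s) * Real.exp (c * s) = 1 := fun s => by
      rw [← Real.exp_add]; simp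
    have hcancel : ∀ s y, Real.exp (-c * s) * (Real.exp (c * s) * y) = y := fun s y => by
      rw [← mul_assoc, hee, one_mul]
    have hfun : X = (fun s => Real.exp (-c * s)) * fun s => Real.exp (c * s) * X s :=
      funext fun s => (hcancel s _).symm
    rw [hfun]
    refine hprod.congr_deriv ?_
    rw [← hfun]
    have := hee t
    linear_combination (c * w t - c * X t) * this
  · rw [hasDeltaDerivAt_iff_of_lt_sigma ht hs]
    refine ⟨hXc.continuousWithinAt, ?_⟩
    have h1 := exp_mul_expAvg_sub hc hm hM' t (sigma T t)
    -- Across the gap the floor is constantly t.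
    have h2 : ∫ s in t..sigma T t, c * Real.exp (c * s) * w (floorPt T s) =
        (Real.exp (c * sigma T t) - Real.exp (c * t)) * w t := by
      rw [← integral_mul_exp, ← intervalIntegral.integral_mul_const,
        intervalIntegral.integral_of_le hs.le, intervalIntegral.integral_of_le hs.le,
        ← integral_Ico_eq_integral_Ioc, ← integral_Ico_eq_integral_Ioc]
      refine setIntegral_congr_fun measurableSet_Ico fun s hs => ?_
      simp only [hT.floorPt_eq_of_mem_Ico ht hs]
    rw [h2, ← hX] at h1
    have h3 := mul_decayRate c (graininess T t)
    have h4 : Real.exp (c * t) = Real.exp (c * sigma T t) * Real.exp (-c * graininess T t) := by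
      rw [← Real.exp_add, graininess]; ring_nf
    rw [h4] at h1
    have h5 := Real.exp_pos (c * sigma T t)
    refine mul_left_cancel₀ h5.ne' ?_
    linear_combination h1 - Real.exp (c * sigma T t) * (w t - X t) * h3

/-- A bounded solution of `d^Δ = -decayRate c μ * d` vanishes. -/
lemma eq_zero_of_hasDeltaDerivAt (hT : IsTwoSided T) (hc : 0 < c) {d : ℝ → ℝ}
    (hd : ∀ t ∈ T, HasDeltaDerivAt T d (-decayRate c (graininess T t) * d t) t)
    (hM : ∀ t ∈ T, |d t| ≤ M) {t : ℝ} (ht : t ∈ T) : d t = 0 := by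
  have hq : ∀ t ∈ T, HasDeltaDerivAt T (fun s => Real.exp (c * s) * d s) 0 t := by
    intro t ht
    rcases (hT.le_sigma t).eq_or_lt with hs | hs
    · have hμ : graininess T t = 0 := by rw [graininess, ← hs, sub_self]
      have h1 := (hasDeltaDerivAt_iff_of_sigma_eq hs.symm).1 (hd t ht)
      rw [hμ, decayRate_zero] at h1
      have hE : HasDerivAt (fun s => Real.exp (c * s)) (c * Real.exp (c * t)) t := by
        simpa [mul_comm] using ((hasDerivAt_id t).const_mul c).exp
      rw [hasDeltaDerivAt_iff_of_sigma_eq hs.symm]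
      refine (hE.hasDerivWithinAt.mul h1).congr_deriv ?_
      ring
    · obtain ⟨h1, h2⟩ := (hasDeltaDerivAt_iff_of_lt_sigma ht hs).1 (hd t ht)
      rw [hasDeltaDerivAt_iff_of_lt_sigma ht hs]
      refine ⟨(Continuous.continuousWithinAt (by fun_prop)).mul h1, ?_⟩
      have h3 := mul_decayRate c (graininess T t)
      have h4 : Real.exp (c * t) = Real.exp (c * sigma T t) * Real.exp (-c * graininess T t) := by
        rw [← Real.exp_add, graininess]; ring_nf
      rw [h4]
      linear_combination Real.exp (c * sigma T t) * h2 - Real.exp (c * sigma T t) * d t * h3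
  -- The constant value of e^{ct} d is read off at the floor of s, with s → -∞ afterwards.
  have hbound : ∀ s ≤ t, |Real.exp (c * t) * d t| ≤ Real.exp (c * s) * M := by
    intro s _
    rw [eq_of_hasDeltaDerivAt_zero hT hq ht (hT.floorPt_mem s), abs_mul,
      abs_of_pos (Real.exp_pos _)]
    have := hM _ (hT.floorPt_mem s)
    have hM0 : 0 ≤ M := (abs_nonneg _).trans this
    gcongr
    exact hT.floorPt_le s
  have hlim : Tendsto (fun s => Real.exp (c * s) * M) atBot (𝓝 (0 * M)) :=
    (Real.tendsto_exp_atBot.comp (tendsto_id.const_mul_atBot hc)).mul_const M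
  rw [zero_mul] at hlim
  have h0 : |Real.exp (c * t) * d t| ≤ 0 :=
    ge_of_tendsto hlim ((eventually_le_atBot t).mono hbound)
  simpa [(Real.exp_pos (c * t)).ne'] using abs_nonpos_iff.1 h0

end

/-! ### Closure properties of continuity at right-dense points -/

namespace RightDenseCont

lemma of_continuousOn {T : Set ℝ} {h : ℝ → ℝ} (hh : ContinuousOn h T) : RightDenseCont T h :=
  fun t ht _ => hh t ht

lemma add {T : Set ℝ} {h k : ℝ → ℝ} (hh : RightDenseCont T h) (hk : RightDenseCont T k) :
    RightDenseCont T fun t => h t + k t :=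
  fun t ht hs => (hh t ht hs).add (hk t ht hs)

lemma sub {T : Set ℝ} {h k : ℝ → ℝ} (hh : RightDenseCont T h) (hk : RightDenseCont T k) :
    RightDenseCont T fun t => h t - k t :=
  fun t ht hs => (hh t ht hs).sub (hk t ht hs)

lemma mul {T : Set ℝ} {h k : ℝ → ℝ} (hh : RightDenseCont T h) (hk : RightDenseCont T k) :
    RightDenseCont T fun t => h t * k t :=
  fun t ht hs => (hh t ht hs).mul (hk t ht hs)

lemma div {T : Set ℝ} {h k : ℝ → ℝ} (hh : RightDenseCont T h) (hk : RightDenseCont T k)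
    (h0 : ∀ t ∈ T, k t ≠ 0) : RightDenseCont T fun t => h t / k t :=
  fun t ht hs => (hh t ht hs).div (hk t ht hs) (h0 t ht)

lemma sum {T : Set ℝ} {ι : Type*} {F : Finset ι} {h : ι → ℝ → ℝ}
    (hh : ∀ i, RightDenseCont T (h i)) : RightDenseCont T fun t => ∑ i ∈ F, h i t :=
  fun t ht hs => tendsto_finsetSum F fun i _ => hh i t ht hs

lemma comp_continuous {T : Set ℝ} {φ h : ℝ → ℝ} (hφ : Continuous φ) (hh : RightDenseCont T h) :
    RightDenseCont T fun t => φ (h t) :=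
  fun t ht hs => hφ.continuousAt.comp_continuousWithinAt (hh t ht hs)

lemma delay {T : Set ℝ} {x τ : ℝ → ℝ} (hx : ContinuousOn x T) (hτ : RightDenseCont T τ)
    (hmem : ∀ t ∈ T, t - τ t ∈ T) : RightDenseCont T fun t => x (t - τ t) :=
  fun t ht hs => ContinuousWithinAt.comp (f := fun t => t - τ t) (hx _ (hmem t ht))
    (continuousWithinAt_id.sub (hτ t ht hs)) hmem

end RightDenseCont

lemma rightDenseCont_graininess {T : Set ℝ} (hT : IsTwoSided T) :
    RightDenseCont T (graininess T) :=
  fun _ _ hs => hT.continuousWithinAt_graininess hs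

lemma intervalIntegrable_of_bdd {M : ℝ} {h : ℝ → ℝ} (hm : Measurable h) (hM : ∀ s, |h s| ≤ M)
    (a b : ℝ) : IntervalIntegrable h volume a b :=
  (intervalIntegrable_const (c := M)).mono_fun hm.aestronglyMeasurable
    (Eventually.of_forall fun s => (hM s).trans (le_abs_self M))

/-- The integral is P(t) - P(t - δ(t)) for the continuous primitive P of the floor extension of `h`.
-/
lemma RightDenseCont.deltaIntegral {T : Set ℝ} (hT : IsTwoSided T) {M : ℝ} {h δ : ℝ → ℝ}
    (hh : RightDenseCont T h) (hM : ∀ t ∈ T, |h t| ≤ M) (hδ : RightDenseCont T δ)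
    (hmem : ∀ t ∈ T, t - δ t ∈ T) :
    RightDenseCont T fun t => TimeScale.deltaIntegral T h (t - δ t) t := by
  have hm := hh.measurable_comp_floorPt hT
  have hint := intervalIntegrable_of_bdd hm fun s => hM _ (hT.floorPt_mem s)
  have hP : Continuous fun b => ∫ s in (0 : ℝ)..b, h (floorPt T s) :=
    intervalIntegral.continuous_primitive hint 0
  have h1 : RightDenseCont T fun t => (∫ s in (0 : ℝ)..t, h (floorPt T s)) -
      ∫ s in (0 : ℝ)..(t - δ t), h (floorPt T s) :=
    (of_continuousOn hP.continuousOn).sub (delay (x := fun b => ∫ s in (0 : ℝ)..b, h (floorPt T s))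
      hP.continuousOn hδ hmem)
  have heq : EqOn (fun t => TimeScale.deltaIntegral T h (t - δ t) t)
      (fun t => (∫ s in (0 : ℝ)..t, h (floorPt T s)) -
        ∫ s in (0 : ℝ)..(t - δ t), h (floorPt T s)) T := fun t ht => by
    simp only [deltaIntegral_eq hT hm (hmem t ht) ht]
    rw [intervalIntegral.integral_interval_sub_left (hint _ _) (hint _ _)]
  exact fun t ht hs => (h1 t ht hs).congr heq (heq ht)

lemma abs_deltaIntegral_le {T : Set ℝ} (hT : IsTwoSided T) {M : ℝ} {h : ℝ → ℝ}
    (hh : RightDenseCont T h) (hM : ∀ t ∈ T, |h t| ≤ M) {a b : ℝ} (ha : a ∈ T) (hb : b ∈ T) :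
    |deltaIntegral T h a b| ≤ M * |b - a| := by
  rw [deltaIntegral_eq hT (hh.measurable_comp_floorPt hT) ha hb]
  exact intervalIntegral.norm_integral_le_of_norm_le_const (f := fun s => h (floorPt T s))
    fun s _ => hM _ (hT.floorPt_mem s)

lemma deltaIntegral_sub {T : Set ℝ} (hT : IsTwoSided T) {M M' : ℝ} {h k : ℝ → ℝ}
    (hh : RightDenseCont T h) (hM : ∀ t ∈ T, |h t| ≤ M) (hk : RightDenseCont T k)
    (hM' : ∀ t ∈ T, |k t| ≤ M') {a b : ℝ} (ha : a ∈ T) (hb : b ∈ T) :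
    deltaIntegral T h a b - deltaIntegral T k a b = deltaIntegral T (fun t => h t - k t) a b := by
  have h1 := hh.measurable_comp_floorPt hT
  have h2 := hk.measurable_comp_floorPt hT
  rw [deltaIntegral_eq hT h1 ha hb, deltaIntegral_eq hT h2 ha hb,
    deltaIntegral_eq hT ((hh.sub hk).measurable_comp_floorPt hT) ha hb,
    intervalIntegral.integral_sub
      (intervalIntegrable_of_bdd h1 (fun s => hM _ (hT.floorPt_mem s)) _ _)
      (intervalIntegrable_of_bdd h2 (fun s => hM' _ (hT.floorPt_mem s)) _ _)]

/-! ### Suprema and infima of almost automorphic functions -/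

namespace AlmostAutomorphic

lemma norm_le_supNorm {X : Type*} [NormedAddCommGroup X] {T : Set ℝ} {h : ℝ → X}
    (hh : AlmostAutomorphic T h) {t : ℝ} (ht : t ∈ T) : ‖h t‖ ≤ supNorm T h := by
  obtain ⟨K, hK⟩ := hh.1
  exact le_csSup ⟨K, by rintro _ ⟨s, hs, rfl⟩; exact hK s hs⟩ ⟨t, ht, rfl⟩

lemma abs_le_supNorm {T : Set ℝ} {h : ℝ → ℝ}
    (hh : AlmostAutomorphic T h) {t : ℝ} (ht : t ∈ T) : |h t| ≤ supNorm T h :=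
  hh.norm_le_supNorm ht

lemma infVal_le {T : Set ℝ} {h : ℝ → ℝ} (hh : AlmostAutomorphic T h) {t : ℝ} (ht : t ∈ T) :
    infVal T h ≤ h t := by
  obtain ⟨K, hK⟩ := hh.1
  refine csInf_le ⟨-K, ?_⟩ ⟨t, ht, rfl⟩
  rintro _ ⟨s, hs, rfl⟩
  exact (abs_le.1 (hK s hs)).1

end AlmostAutomorphic

lemma supNorm_nonneg {X : Type*} [NormedAddCommGroup X] (T : Set ℝ) (h : ℝ → X) :
    0 ≤ supNorm T h :=
  Real.sSup_nonneg (by rintro _ ⟨s, -, rfl⟩; exact norm_nonneg _)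

/-! ### The network: bounds and Lipschitz estimates -/

/-- The data of a shunting inhibitory network on an `m × n` lattice. -/
structure Network (m n : ℕ) where
  /-- radius of the delayed inhibition -/
  r : ℕ
  /-- radius of the distributed inhibition -/
  p : ℕ
  /-- decay rates -/
  a : Fin m → Fin n → ℝ → ℝ
  /-- external inputs -/
  L : Fin m → Fin n → ℝ → ℝ
  /-- discrete delays -/
  τ : Fin m → Fin n → ℝ → ℝ
  /-- distributed delays -/
  δ : Fin m → Fin n → ℝ → ℝ
  /-- connection weights of the delayed inhibition -/
  B : Fin m → Fin n → Fin m → Fin n → ℝ → ℝ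
  /-- connection weights of the distributed inhibition -/
  C : Fin m → Fin n → Fin m → Fin n → ℝ → ℝ
  /-- activation of the delayed inhibition -/
  f : ℝ → ℝ
  /-- activation of the distributed inhibition -/
  g : ℝ → ℝ

namespace Network

variable {m n : ℕ}

/-- The total inhibition received by the cell `(i, j)`. -/
def inhibition (N : Network m n) (T : Set ℝ) (x : ℝ → Fin m → Fin n → ℝ) (i : Fin m) (j : Fin n)
    (t : ℝ) : ℝ :=
  (∑ c ∈ nbhd N.r i j, N.B i j c.1 c.2 t * N.f (x (t - N.τ c.1 c.2 t) c.1 c.2)) +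
    ∑ c ∈ nbhd N.p i j, N.C i j c.1 c.2 t *
      deltaIntegral T (fun u => N.g (x u c.1 c.2)) (t - N.δ c.1 c.2 t) t

/-- The part of the right-hand side other than the linear decay. -/
def forcing (N : Network m n) (T : Set ℝ) (x : ℝ → Fin m → Fin n → ℝ) (i : Fin m) (j : Fin n)
    (t : ℝ) : ℝ :=
  N.L i j t - N.inhibition T x i j t * x t i j

/-- The function whose exponential average is `x` exactly when `x` solves the network equation. -/
def target (N : Network m n) (T : Set ℝ) (c : ℝ) (x : ℝ → Fin m → Fin n → ℝ) (i : Fin m)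
    (j : Fin n) (t : ℝ) : ℝ :=
  x t i j + (-(N.a i j t) * x t i j + N.forcing T x i j t) / decayRate c (graininess T t)

lemma isSICNNSolution_iff (N : Network m n) {T : Set ℝ} {x : ℝ → Fin m → Fin n → ℝ} :
    IsSICNNSolution T N.r N.p N.a N.L N.τ N.δ N.B N.C N.f N.g x ↔
      ∀ t ∈ T, ∀ i j, HasDeltaDerivAt T (fun s => x s i j)
        (-(N.a i j t) * x t i j + N.forcing T x i j t) t := by
  refine forall_congr' fun t => forall_congr' fun _ => forall_congr' fun i =>
    forall_congr' fun j => ?_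
  have : -(N.a i j t) * x t i j + N.forcing T x i j t = -(N.a i j t) * x t i j
        - (∑ c ∈ nbhd N.r i j,
            N.B i j c.1 c.2 t * N.f (x (t - N.τ c.1 c.2 t) c.1 c.2) * x t i j)
        - (∑ c ∈ nbhd N.p i j,
            N.C i j c.1 c.2 t
              * deltaIntegral T (fun u => N.g (x u c.1 c.2)) (t - N.δ c.1 c.2 t) t * x t i j)
        + N.L i j t := by
    rw [forcing, inhibition, ← Finset.sum_mul, ← Finset.sum_mul]
    ring
  rw [this]

/-- The standing assumptions on the network, for states bounded by `ρ`. -/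
structure Admissible (N : Network m n) (T : Set ℝ) (ρ Mf Lf Mg Lg : ℝ) : Prop where
  rho_nonneg : 0 ≤ ρ
  Lf_nonneg : 0 ≤ Lf
  Mg_nonneg : 0 ≤ Mg
  Lg_nonneg : 0 ≤ Lg
  a_pos : ∀ i j, 0 < infVal T (N.a i j)
  regressive : ∀ i j, ∀ t ∈ T, graininess T t * N.a i j t < 1
  τ_mem : ∀ k l, ∀ t ∈ T, t - N.τ k l t ∈ T
  δ_mem : ∀ k l, ∀ t ∈ T, t - N.δ k l t ∈ T
  aa_a : ∀ i j, AlmostAutomorphic T (N.a i j)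
  aa_L : ∀ i j, AlmostAutomorphic T (N.L i j)
  aa_τ : ∀ i j, AlmostAutomorphic T (N.τ i j)
  aa_δ : ∀ i j, AlmostAutomorphic T (N.δ i j)
  aa_B : ∀ i j k l, AlmostAutomorphic T (N.B i j k l)
  aa_C : ∀ i j k l, AlmostAutomorphic T (N.C i j k l)
  f_cont : Continuous N.f
  g_cont : Continuous N.g
  f_lip : ∀ u v, |N.f u - N.f v| ≤ Lf * |u - v|
  g_lip : ∀ u v, |N.g u - N.g v| ≤ Lg * |u - v|
  f_le : ∀ u, |u| ≤ ρ → |N.f u| ≤ Mf * ρ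
  g_le : ∀ u, |u| ≤ ρ → |N.g u| ≤ Mg * ρ

/-- `x` is continuous on `T` and bounded by `ρ` there. -/
structure IsState (T : Set ℝ) (ρ : ℝ) (x : ℝ → Fin m → Fin n → ℝ) : Prop where
  cont : ∀ i j, ContinuousOn (fun t => x t i j) T
  le : ∀ t ∈ T, ∀ i j, |x t i j| ≤ ρ

/-- The bound for the forcing of states bounded by `ρ`. -/
def forcingBound (N : Network m n) (T : Set ℝ) (ρ Mf Mg : ℝ) (i : Fin m) (j : Fin n) : ℝ :=
  (∑ c ∈ nbhd N.r i j, supNorm T (N.B i j c.1 c.2) * Mf * ρ ^ 2)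
    + (∑ c ∈ nbhd N.p i j, supNorm T (N.C i j c.1 c.2) * Mg * supNorm T (N.δ c.1 c.2) * ρ ^ 2)
    + supNorm T (N.L i j)

/-- The Lipschitz constant of the forcing on states bounded by `ρ`. -/
def forcingLip (N : Network m n) (T : Set ℝ) (ρ Mf Lf Mg Lg : ℝ) (i : Fin m) (j : Fin n) : ℝ :=
  (∑ c ∈ nbhd N.r i j, supNorm T (N.B i j c.1 c.2) * (Mf + Lf) * ρ)
    + (∑ c ∈ nbhd N.p i j,
      supNorm T (N.C i j c.1 c.2) * (Mg + Lg) * supNorm T (N.δ c.1 c.2) * ρ)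

namespace Admissible

variable {N : Network m n} {T : Set ℝ} {ρ Mf Lf Mg Lg : ℝ}

lemma rightDenseCont_g (hN : N.Admissible T ρ Mf Lf Mg Lg)
    {x : ℝ → Fin m → Fin n → ℝ} (hx : IsState T ρ x) (k : Fin m) (l : Fin n) :
    RightDenseCont T fun u => N.g (x u k l) :=
  (RightDenseCont.of_continuousOn (hx.cont k l)).comp_continuous hN.g_cont

lemma rightDenseCont_inhibition (hN : N.Admissible T ρ Mf Lf Mg Lg) (hT : IsTwoSided T)
    {x : ℝ → Fin m → Fin n → ℝ} (hx : IsState T ρ x) (i : Fin m) (j : Fin n) :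
    RightDenseCont T (N.inhibition T x i j) := by
  refine RightDenseCont.add (RightDenseCont.sum fun c => ?_) (RightDenseCont.sum fun c => ?_)
  · exact ((hN.aa_B i j c.1 c.2).2.1.rightDenseCont hT).mul (.comp_continuous hN.f_cont
      (.delay (hx.cont c.1 c.2) ((hN.aa_τ c.1 c.2).2.1.rightDenseCont hT) (hN.τ_mem c.1 c.2)))
  · exact ((hN.aa_C i j c.1 c.2).2.1.rightDenseCont hT).mul (.deltaIntegral hT
      (hN.rightDenseCont_g hx c.1 c.2) (fun t ht => hN.g_le _ (hx.le t ht c.1 c.2))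
      ((hN.aa_δ c.1 c.2).2.1.rightDenseCont hT) (hN.δ_mem c.1 c.2))

lemma rightDenseCont_target (hN : N.Admissible T ρ Mf Lf Mg Lg) (hT : IsTwoSided T)
    {x : ℝ → Fin m → Fin n → ℝ} (hx : IsState T ρ x) {c : ℝ}
    (hc : ∀ t ∈ T, decayRate c (graininess T t) ≠ 0) (i : Fin m) (j : Fin n) :
    RightDenseCont T (N.target T c x i j) := by
  have h1 := RightDenseCont.of_continuousOn (hx.cont i j)
  have h2 := (hN.aa_a i j).2.1.rightDenseCont hT
  have h3 := (hN.aa_L i j).2.1.rightDenseCont hT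
  refine h1.add (RightDenseCont.div (RightDenseCont.add (RightDenseCont.mul ?_ h1)
    (h3.sub ((hN.rightDenseCont_inhibition hT hx i j).mul h1)))
    ((rightDenseCont_graininess hT).comp_continuous (continuous_decayRate c)) hc)
  exact h2.comp_continuous continuous_neg

lemma abs_deltaIntegral_g_le (hN : N.Admissible T ρ Mf Lf Mg Lg) (hT : IsTwoSided T)
    {x : ℝ → Fin m → Fin n → ℝ} (hx : IsState T ρ x) {t : ℝ} (ht : t ∈ T) (k : Fin m)
    (l : Fin n) :
    |deltaIntegral T (fun u => N.g (x u k l)) (t - N.δ k l t) t| ≤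
      Mg * ρ * supNorm T (N.δ k l) := by
  refine (abs_deltaIntegral_le hT (hN.rightDenseCont_g hx k l)
    (fun s hs => hN.g_le _ (hx.le s hs k l)) (hN.δ_mem k l t ht) ht).trans ?_
  rw [sub_sub_cancel]
  exact mul_le_mul_of_nonneg_left ((hN.aa_δ k l).abs_le_supNorm ht)
    (mul_nonneg hN.Mg_nonneg hN.rho_nonneg)

lemma abs_inhibition_le (hN : N.Admissible T ρ Mf Lf Mg Lg) (hT : IsTwoSided T)
    {x : ℝ → Fin m → Fin n → ℝ} (hx : IsState T ρ x) {t : ℝ} (ht : t ∈ T) (i : Fin m)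
    (j : Fin n) :
    |N.inhibition T x i j t| ≤ (∑ c ∈ nbhd N.r i j, supNorm T (N.B i j c.1 c.2) * (Mf * ρ)) +
      ∑ c ∈ nbhd N.p i j, supNorm T (N.C i j c.1 c.2) * (Mg * ρ * supNorm T (N.δ c.1 c.2)) := by
  refine (abs_add_le _ _).trans (add_le_add ((Finset.abs_sum_le_sum_abs _ _).trans
    (Finset.sum_le_sum fun c _ => ?_)) ((Finset.abs_sum_le_sum_abs _ _).trans
    (Finset.sum_le_sum fun c _ => ?_)))
  · rw [abs_mul]
    exact mul_le_mul ((hN.aa_B i j c.1 c.2).abs_le_supNorm ht)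
      (hN.f_le _ (hx.le _ (hN.τ_mem c.1 c.2 t ht) c.1 c.2)) (abs_nonneg _) (supNorm_nonneg _ _)
  · rw [abs_mul]
    exact mul_le_mul ((hN.aa_C i j c.1 c.2).abs_le_supNorm ht)
      (hN.abs_deltaIntegral_g_le hT hx ht c.1 c.2) (abs_nonneg _) (supNorm_nonneg _ _)

lemma abs_inhibition_sub_le (hN : N.Admissible T ρ Mf Lf Mg Lg) (hT : IsTwoSided T)
    {x y : ℝ → Fin m → Fin n → ℝ} (hx : IsState T ρ x) (hy : IsState T ρ y) {D : ℝ}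
    (hD : ∀ t ∈ T, ∀ i j, |x t i j - y t i j| ≤ D) {t : ℝ} (ht : t ∈ T) (i : Fin m)
    (j : Fin n) :
    |N.inhibition T x i j t - N.inhibition T y i j t| ≤
      (∑ c ∈ nbhd N.r i j, supNorm T (N.B i j c.1 c.2) * (Lf * D)) +
      ∑ c ∈ nbhd N.p i j, supNorm T (N.C i j c.1 c.2) * (Lg * D * supNorm T (N.δ c.1 c.2)) := by
  have hD0 : 0 ≤ D := (abs_nonneg _).trans (hD t ht i j)
  rw [inhibition, inhibition, add_sub_add_comm, ← Finset.sum_sub_distrib,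
    ← Finset.sum_sub_distrib]
  refine (abs_add_le _ _).trans (add_le_add ((Finset.abs_sum_le_sum_abs _ _).trans
    (Finset.sum_le_sum fun c _ => ?_)) ((Finset.abs_sum_le_sum_abs _ _).trans
    (Finset.sum_le_sum fun c _ => ?_)))
  · rw [← mul_sub, abs_mul]
    refine mul_le_mul ((hN.aa_B i j c.1 c.2).abs_le_supNorm ht) ((hN.f_lip _ _).trans ?_)
      (abs_nonneg _) (supNorm_nonneg _ _)
    exact mul_le_mul_of_nonneg_left (hD _ (hN.τ_mem c.1 c.2 t ht) c.1 c.2) hN.Lf_nonneg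
  · have hgx := hN.rightDenseCont_g hx c.1 c.2
    have hgy := hN.rightDenseCont_g hy c.1 c.2
    rw [← mul_sub, abs_mul, deltaIntegral_sub hT hgx (fun s hs => hN.g_le _ (hx.le s hs c.1 c.2))
      hgy (fun s hs => hN.g_le _ (hy.le s hs c.1 c.2)) (hN.δ_mem c.1 c.2 t ht) ht]
    refine mul_le_mul ((hN.aa_C i j c.1 c.2).abs_le_supNorm ht) ((abs_deltaIntegral_le hT
      (hgx.sub hgy) (M := Lg * D) (fun s hs => (hN.g_lip _ _).trans
        (mul_le_mul_of_nonneg_left (hD s hs c.1 c.2) hN.Lg_nonneg))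
      (hN.δ_mem c.1 c.2 t ht) ht).trans ?_) (abs_nonneg _) (supNorm_nonneg _ _)
    rw [sub_sub_cancel]
    exact mul_le_mul_of_nonneg_left ((hN.aa_δ c.1 c.2).abs_le_supNorm ht)
      (mul_nonneg hN.Lg_nonneg hD0)

lemma abs_forcing_le (hN : N.Admissible T ρ Mf Lf Mg Lg) (hT : IsTwoSided T)
    {x : ℝ → Fin m → Fin n → ℝ} (hx : IsState T ρ x) {t : ℝ} (ht : t ∈ T) (i : Fin m)
    (j : Fin n) : |N.forcing T x i j t| ≤ N.forcingBound T ρ Mf Mg i j := by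
  have h1 := hN.abs_inhibition_le hT hx ht i j
  have h2 := mul_le_mul h1 (hx.le t ht i j) (abs_nonneg _) ((abs_nonneg _).trans h1)
  rw [← abs_mul] at h2
  refine (abs_sub _ _).trans ((add_le_add ((hN.aa_L i j).abs_le_supNorm ht) h2).trans_eq ?_)
  rw [forcingBound, add_mul, Finset.sum_mul, Finset.sum_mul, add_comm]
  congr 2 <;> exact Finset.sum_congr rfl fun c _ => by ring

lemma abs_forcing_sub_le (hN : N.Admissible T ρ Mf Lf Mg Lg) (hT : IsTwoSided T)
    {x y : ℝ → Fin m → Fin n → ℝ} (hx : IsState T ρ x) (hy : IsState T ρ y) {D : ℝ}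
    (hD : ∀ t ∈ T, ∀ i j, |x t i j - y t i j| ≤ D) {t : ℝ} (ht : t ∈ T) (i : Fin m)
    (j : Fin n) :
    |N.forcing T x i j t - N.forcing T y i j t| ≤ N.forcingLip T ρ Mf Lf Mg Lg i j * D := by
  have hD0 : 0 ≤ D := (abs_nonneg _).trans (hD t ht i j)
  have h1 := hN.abs_inhibition_le hT hx ht i j
  have h2 := hN.abs_inhibition_sub_le hT hx hy hD ht i j
  -- Splitting the difference of products: the first term is controlled by the bounds Mf, Mg, the
  -- second by the Lipschitz constants Lf, Lg, which explains the sums Mf + Lf and Mg + Lg.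
  have h3 : N.forcing T x i j t - N.forcing T y i j t =
      -(N.inhibition T x i j t * (x t i j - y t i j) +
        (N.inhibition T x i j t - N.inhibition T y i j t) * y t i j) := by
    rw [forcing, forcing]; ring
  rw [h3, abs_neg]
  refine (abs_add_le _ _).trans ?_
  rw [abs_mul, abs_mul]
  refine (add_le_add (mul_le_mul h1 (hD t ht i j) (abs_nonneg _) ((abs_nonneg _).trans h1))
    (mul_le_mul h2 (hy.le t ht i j) (abs_nonneg _) ((abs_nonneg _).trans h2))).trans_eq ?_
  rw [forcingLip]
  simp only [add_mul, Finset.sum_mul, mul_add, Finset.sum_add_distrib]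
  rw [add_add_add_comm]
  simp only [← Finset.sum_add_distrib]
  congr 1 <;> exact Finset.sum_congr rfl fun c _ => by ring

end Admissible

end Network

/-! ### Shifts and periods of the time scale -/

/-- `s` is a sequence of periods of `T`. -/
def IsPeriodSeq (T : Set ℝ) (s : ℕ → ℝ) : Prop :=
  ∀ k, ∀ t ∈ T, t + s k ∈ T ∧ t - s k ∈ T

/-- Every difference v - u of points of T is a shift, so a core point t₀ satisfies t₀ + (v - u) ∈ T.
Iterating, T - t₀ is a subgroup of ℝ, and it contains all shifts. -/
lemma add_mem_of_core_nonempty {T : Set ℝ} (hc : (core T).Nonempty) {τ t : ℝ} (hτ : τ ∈ shifts T)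
    (ht : t ∈ T) : t + τ ∈ T ∧ t - τ ∈ T := by
  obtain ⟨t₀, h₀⟩ := hc
  have h : ∀ u ∈ T, ∀ v ∈ T, t₀ + (v - u) ∈ T := fun u hu v hv =>
    (mem_iInter₂.1 h₀ (v - u) ⟨u, hu, by simpa using hv⟩).2
  obtain ⟨u, hu, huv⟩ := hτ
  have h₀T : t₀ ∈ T := (mem_iInter₂.1 h₀ τ ⟨u, hu, huv⟩).1
  constructor
  · have h1 := h _ (h _ huv _ hu) _ (h _ h₀T _ ht)
    have h2 := h _ h₀T _ h1
    convert h _ (h _ huv _ hu) _ ht using 1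
    ring
  · convert h _ (h _ hu _ huv) _ ht using 1
    ring

lemma isPeriodSeq_of_core_nonempty {T : Set ℝ} (hc : (core T).Nonempty) {s : ℕ → ℝ}
    (hs : ∀ k, s k ∈ shifts T) : IsPeriodSeq T s :=
  fun k _ ht => add_mem_of_core_nonempty hc (hs k) ht

lemma core_subset {T : Set ℝ} (hne : T.Nonempty) : core T ⊆ T := by
  obtain ⟨t, ht⟩ := hne
  exact fun u hu => (mem_iInter₂.1 hu 0 ⟨t, ht, by simpa using ht⟩).1

lemma core_eq_of_nonempty {T : Set ℝ} (hc : (core T).Nonempty) (hne : T.Nonempty) :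
    core T = T :=
  Subset.antisymm (core_subset hne) fun _ ht =>
    mem_iInter₂.2 fun _ hτ => ⟨ht, (add_mem_of_core_nonempty hc hτ ht).1⟩

namespace IsPeriodSeq

lemma floorPt_add {T : Set ℝ} {s : ℕ → ℝ} (hs : IsPeriodSeq T s) (hT : IsTwoSided T) (k : ℕ)
    (u : ℝ) : floorPt T (u + s k) = floorPt T u + s k := by
  refine le_antisymm ?_ (le_floorPt (hs k _ (hT.floorPt_mem u)).1
    (add_le_add_left (hT.floorPt_le u) _))
  rw [← sub_le_iff_le_add]
  refine le_floorPt (hs k _ (hT.floorPt_mem _)).2 ?_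
  linarith [hT.floorPt_le (u + s k)]

lemma floorPt_sub {T : Set ℝ} {s : ℕ → ℝ} (hs : IsPeriodSeq T s) (hT : IsTwoSided T) (k : ℕ)
    (u : ℝ) : floorPt T (u - s k) = floorPt T u - s k := by
  have := hs.floorPt_add hT k (u - s k)
  rw [sub_add_cancel] at this
  rw [this, add_sub_cancel_right]

lemma sigma_add {T : Set ℝ} {s : ℕ → ℝ} (hs : IsPeriodSeq T s) (hT : IsTwoSided T) (k : ℕ)
    (t : ℝ) : sigma T (t + s k) = sigma T t + s k := by
  have key : ∀ u r, (∀ v ∈ T, v - r ∈ T) → sigma T (u - r) ≤ sigma T u - r := fun u r hr => by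
    rw [sigma.eq_def T u, if_pos (hT.above u), le_sub_iff_add_le]
    exact le_csInf (hT.above u) fun v hv => le_sub_iff_add_le.1
      (hT.sigma_le (hr v hv.1) (sub_lt_sub_right hv.2 r))
  have h1 := key (t + s k) (s k) fun v hv => (hs k v hv).2
  have h2 := key t (-s k) fun v hv => by simpa using (hs k v hv).1
  rw [add_sub_cancel_right] at h1
  rw [sub_neg_eq_add, sub_neg_eq_add] at h2
  linarith

lemma graininess_add {T : Set ℝ} {s : ℕ → ℝ} (hs : IsPeriodSeq T s) (hT : IsTwoSided T) (k : ℕ)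
    (t : ℝ) : graininess T (t + s k) = graininess T t := by
  rw [graininess, graininess, hs.sigma_add hT]
  ring

lemma graininess_sub {T : Set ℝ} {s : ℕ → ℝ} (hs : IsPeriodSeq T s) (hT : IsTwoSided T) (k : ℕ)
    (t : ℝ) : graininess T (t - s k) = graininess T t := by
  have := hs.graininess_add hT k (t - s k)
  rw [sub_add_cancel] at this
  exact this.symm

lemma comp {T : Set ℝ} {s : ℕ → ℝ} (hs : IsPeriodSeq T s) (θ : ℕ → ℕ) :
    IsPeriodSeq T fun k => s (θ k) := fun k => hs (θ k)

end IsPeriodSeq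

/-! ### Recurrence along a sequence of periods -/

/-- The translates of `h` along `s` converge on `T`, and translating the limit back recovers `h`. -/
def Recurs (T : Set ℝ) (s : ℕ → ℝ) (h : ℝ → ℝ) : Prop :=
  ∃ h' : ℝ → ℝ, (∀ t ∈ T, Tendsto (fun k => h (t + s k)) atTop (𝓝 (h' t))) ∧
    ∀ t ∈ T, Tendsto (fun k => h' (t - s k)) atTop (𝓝 (h t))

namespace Recurs

variable {T : Set ℝ} {s : ℕ → ℝ} {h k x : ℝ → ℝ}

lemma comp_strictMono {θ : ℕ → ℕ} (hh : Recurs T s h) (hθ : StrictMono θ) :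
    Recurs T (fun k => s (θ k)) h := by
  obtain ⟨h', h1, h2⟩ := hh
  exact ⟨h', fun t ht => (h1 t ht).comp hθ.tendsto_atTop,
    fun t ht => (h2 t ht).comp hθ.tendsto_atTop⟩

lemma const (c : ℝ) : Recurs T s fun _ => c :=
  ⟨fun _ => c, fun _ _ => tendsto_const_nhds, fun _ _ => tendsto_const_nhds⟩

lemma add (hh : Recurs T s h) (hk : Recurs T s k) : Recurs T s fun t => h t + k t := by
  obtain ⟨h', h1, h2⟩ := hh
  obtain ⟨k', h3, h4⟩ := hk
  exact ⟨fun t => h' t + k' t, fun t ht => (h1 t ht).add (h3 t ht),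
    fun t ht => (h2 t ht).add (h4 t ht)⟩

lemma mul (hh : Recurs T s h) (hk : Recurs T s k) : Recurs T s fun t => h t * k t := by
  obtain ⟨h', h1, h2⟩ := hh
  obtain ⟨k', h3, h4⟩ := hk
  exact ⟨fun t => h' t * k' t, fun t ht => (h1 t ht).mul (h3 t ht),
    fun t ht => (h2 t ht).mul (h4 t ht)⟩

lemma comp_continuous {φ : ℝ → ℝ} (hφ : Continuous φ) (hh : Recurs T s h) :
    Recurs T s fun t => φ (h t) := by
  obtain ⟨h', h1, h2⟩ := hh
  exact ⟨fun t => φ (h' t), fun t ht => (hφ.tendsto _).comp (h1 t ht),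
    fun t ht => (hφ.tendsto _).comp (h2 t ht)⟩

lemma sub (hh : Recurs T s h) (hk : Recurs T s k) : Recurs T s fun t => h t - k t := by
  simpa only [sub_eq_add_neg] using hh.add (hk.comp_continuous continuous_neg)

lemma sum {ι : Type*} {F : Finset ι} {h : ι → ℝ → ℝ} (hh : ∀ i, Recurs T s (h i)) :
    Recurs T s fun t => ∑ i ∈ F, h i t := by
  choose h' h1 h2 using hh
  exact ⟨fun t => ∑ i ∈ F, h' i t, fun t ht => tendsto_finsetSum F fun i _ => h1 i t ht,
    fun t ht => tendsto_finsetSum F fun i _ => h2 i t ht⟩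

/-- A function invariant under the translations `s` recurs. -/
lemma of_invariant (h1 : ∀ j t, h (t + s j) = h t) (h2 : ∀ j t, h (t - s j) = h t) :
    Recurs T s h :=
  ⟨h, fun t _ => by simp only [h1, tendsto_const_nhds], fun t _ => by
    simp only [h2, tendsto_const_nhds]⟩

/-- Pointwise convergence alone does not survive moving arguments; a common Lipschitz constant makes
the displacement harmless. -/
lemma tendsto_of_lipschitz {X : ℕ → ℝ → ℝ} {X' : ℝ → ℝ} {K : ℝ} {q : ℕ → ℝ} {q' : ℝ}
    (hX : ∀ j, ∀ u ∈ T, ∀ v ∈ T, |X j u - X j v| ≤ K * |u - v|) (hq : ∀ j, q j ∈ T)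
    (hq' : q' ∈ T) (hlim : Tendsto q atTop (𝓝 q'))
    (hXlim : Tendsto (fun j => X j q') atTop (𝓝 (X' q'))) :
    Tendsto (fun j => X j (q j)) atTop (𝓝 (X' q')) := by
  have h1 : Tendsto (fun j => X j (q j) - X j q') atTop (𝓝 0) := by
    refine squeeze_zero_norm (fun j => hX j _ (hq j) _ hq') ?_
    simpa using ((hlim.sub_const q').abs).const_mul K
  simpa using h1.add hXlim

lemma sub_mem_of_tendsto (hT : IsClosed T) (hs : IsPeriodSeq T s) {τ τ' : ℝ → ℝ}
    (hmem : ∀ t ∈ T, t - τ t ∈ T) {t : ℝ} (ht : t ∈ T)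
    (hτ : Tendsto (fun k => τ (t + s k)) atTop (𝓝 (τ' t))) : t - τ' t ∈ T := by
  refine hT.mem_of_tendsto (hτ.const_sub t) (Eventually.of_forall fun k => ?_)
  have := (hs k _ (hmem _ (hs k t ht).1)).2
  rwa [show t + s k - τ (t + s k) - s k = t - τ (t + s k) by ring] at this

lemma lipschitz_limit {K : ℝ} {x' : ℝ → ℝ} (hs : IsPeriodSeq T s)
    (hx : ∀ u ∈ T, ∀ v ∈ T, |x u - x v| ≤ K * |u - v|)
    (hlim : ∀ t ∈ T, Tendsto (fun k => x (t + s k)) atTop (𝓝 (x' t))) :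
    ∀ u ∈ T, ∀ v ∈ T, |x' u - x' v| ≤ K * |u - v| := fun u hu v hv => by
  refine le_of_tendsto ((hlim u hu).sub (hlim v hv)).abs (Eventually.of_forall fun k => ?_)
  simpa using hx _ (hs k u hu).1 _ (hs k v hv).1

/-- The translates of `x` and of its limit share the constant K, so they may be evaluated at the
converging arguments t - τ(t + s_k). These lie in T because s_k is a period, and their limit does
because T is closed. -/
lemma delay {K : ℝ} {τ : ℝ → ℝ} (hT : IsClosed T) (hs : IsPeriodSeq T s) (hx : Recurs T s x)
    (hlip : ∀ u ∈ T, ∀ v ∈ T, |x u - x v| ≤ K * |u - v|) (hτ : Recurs T s τ)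
    (hmem : ∀ t ∈ T, t - τ t ∈ T) : Recurs T s fun t => x (t - τ t) := by
  obtain ⟨x', h1, h2⟩ := hx
  obtain ⟨τ', h3, h4⟩ := hτ
  have hmem' : ∀ t ∈ T, t - τ' t ∈ T := fun t ht => sub_mem_of_tendsto hT hs hmem ht (h3 t ht)
  have hlip' := lipschitz_limit hs hlip h1
  refine ⟨fun t => x' (t - τ' t), fun t ht => ?_, fun t ht => ?_⟩
  · have := tendsto_of_lipschitz (X := fun k u => x (u + s k)) (X' := x') (K := K)
      (q := fun k => t - τ (t + s k)) (fun k u hu v hv => by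
        simpa using hlip _ (hs k u hu).1 _ (hs k v hv).1) (fun k => ?_) (hmem' t ht)
      ((h3 t ht).const_sub t) (h1 _ (hmem' t ht))
    · refine this.congr fun k => ?_
      rw [show t - τ (t + s k) + s k = t + s k - τ (t + s k) by ring]
    · rw [show t - τ (t + s k) = t + s k - τ (t + s k) - s k by ring]
      exact (hs k _ (hmem _ (hs k t ht).1)).2
  · have := tendsto_of_lipschitz (X := fun k u => x' (u - s k)) (X' := x) (K := K)
      (q := fun k => t - τ' (t - s k)) (fun k u hu v hv => by
        simpa using hlip' _ (hs k u hu).2 _ (hs k v hv).2) (fun k => ?_) (hmem t ht)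
      ((h4 t ht).const_sub t) (h2 _ (hmem t ht))
    · refine this.congr fun k => ?_
      rw [show t - τ' (t - s k) - s k = t - s k - τ' (t - s k) by ring]
    · rw [show t - τ' (t - s k) = t - s k - τ' (t - s k) + s k by ring]
      exact (hs k _ (hmem' _ (hs k t ht).2)).1

lemma measurable_limit (hT : IsTwoSided T) (hs : IsPeriodSeq T s) {h' : ℝ → ℝ}
    (hm : Measurable fun u => h (floorPt T u))
    (hlim : ∀ t ∈ T, Tendsto (fun k => h (t + s k)) atTop (𝓝 (h' t))) :
    Measurable fun u => h' (floorPt T u) := by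
  refine measurable_of_tendsto_metrizable (f := fun k u => h (floorPt T (u + s k))) (fun k => ?_)
    (tendsto_pi_nhds.2 fun u => ?_)
  · exact hm.comp (measurable_id.add_const _)
  · simp only [hs.floorPt_add hT]
    exact hlim _ (hT.floorPt_mem u)

lemma bdd_limit {M : ℝ} {h' : ℝ → ℝ} (hs : IsPeriodSeq T s) (hM : ∀ t ∈ T, |h t| ≤ M)
    (hlim : ∀ t ∈ T, Tendsto (fun k => h (t + s k)) atTop (𝓝 (h' t))) :
    ∀ t ∈ T, |h' t| ≤ M := fun t ht =>
  le_of_tendsto (hlim t ht).abs (Eventually.of_forall fun k => hM _ (hs k t ht).1)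

lemma tendsto_integral_floorPt (hT : IsTwoSided T) {M : ℝ} {H : ℕ → ℝ → ℝ} {H' : ℝ → ℝ}
    (hm : ∀ j, Measurable fun u => H j (floorPt T u)) (hM : ∀ j, ∀ t ∈ T, |H j t| ≤ M)
    (hlim : ∀ t ∈ T, Tendsto (fun j => H j t) atTop (𝓝 (H' t))) {q : ℕ → ℝ} {q' : ℝ}
    (hq : Tendsto q atTop (𝓝 q')) (t : ℝ) :
    Tendsto (fun j => ∫ u in q j..t, H j (floorPt T u)) atTop
      (𝓝 (∫ u in q'..t, H' (floorPt T u))) := by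
  have hint : ∀ j a b, IntervalIntegrable (fun u => H j (floorPt T u)) volume a b := fun j =>
    intervalIntegrable_of_bdd (hm j) fun u => hM j _ (hT.floorPt_mem u)
  -- The integral is M-Lipschitz in its lower end, uniformly in j, so that end may be frozen at its
  -- limit.
  refine tendsto_of_lipschitz (T := univ) (X := fun j b => ∫ u in b..t, H j (floorPt T u))
    (X' := fun b => ∫ u in b..t, H' (floorPt T u)) (K := M) (fun j b _ b' _ => ?_)
    (fun _ => mem_univ _) (mem_univ _) hq ?_
  · rw [intervalIntegral.integral_interval_sub_interval_comm' (hint _ _ _) (hint _ _ _)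
      (hint _ _ _), intervalIntegral.integral_same, zero_sub, abs_neg]
    exact intervalIntegral.norm_integral_le_of_norm_le_const
      (f := fun u => H j (floorPt T u)) fun u _ => hM j _ (hT.floorPt_mem u)
  · exact intervalIntegral.tendsto_integral_filter_of_dominated_convergence (fun _ => M)
      (Eventually.of_forall fun j => (hm j).aestronglyMeasurable)
      (Eventually.of_forall fun j => Eventually.of_forall fun u _ => hM j _ (hT.floorPt_mem u))
      intervalIntegrable_const
      (Eventually.of_forall fun u _ => hlim _ (hT.floorPt_mem u))

lemma deltaIntegral {M : ℝ} {δ : ℝ → ℝ} (hT : IsTwoSided T) (hs : IsPeriodSeq T s)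
    (hh : Recurs T s h) (hm : Measurable fun u => h (floorPt T u)) (hM : ∀ t ∈ T, |h t| ≤ M)
    (hδ : Recurs T s δ) (hmem : ∀ t ∈ T, t - δ t ∈ T) :
    Recurs T s fun t => TimeScale.deltaIntegral T h (t - δ t) t := by
  obtain ⟨h', h1, h2⟩ := hh
  obtain ⟨δ', h3, h4⟩ := hδ
  have hm' := measurable_limit hT hs hm h1
  have hM' := bdd_limit hs hM h1
  have hadd : ∀ j u, h (floorPt T u + s j) = h (floorPt T (u + s j)) := fun j u => by
    rw [hs.floorPt_add hT]
  have hsub : ∀ j u, h' (floorPt T u - s j) = h' (floorPt T (u - s j)) := fun j u => by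
    rw [hs.floorPt_sub hT]
  -- Writing the limit as a Lebesgue integral avoids asking whether t - δ'(t) lies in T.
  refine ⟨fun t => ∫ u in (t - δ' t)..t, h' (floorPt T u), fun t ht => ?_, fun t ht => ?_⟩
  · have := tendsto_integral_floorPt hT (H := fun j u => h (u + s j)) (M := M)
      (fun j => by simp only [hadd]; exact hm.comp (measurable_id.add_const _))
      (fun j u hu => hM _ (hs j u hu).1) h1 ((h3 t ht).const_sub t) t
    refine this.congr fun j => ?_
    have hj := (hs j t ht).1
    beta_reduce
    rw [deltaIntegral_eq hT hm (hmem _ hj) hj]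
    simp only [hadd]
    rw [intervalIntegral.integral_comp_add_right fun u => h (floorPt T u)]
    congr 1
    ring
  · have := tendsto_integral_floorPt hT (H := fun j u => h' (u - s j)) (M := M)
      (fun j => by simp only [hsub]; exact hm'.comp (measurable_id.sub_const _))
      (fun j u hu => hM' _ (hs j u hu).2) h2 ((h4 t ht).const_sub t) t
    rw [← deltaIntegral_eq hT hm (hmem t ht) ht] at this
    refine this.congr fun j => ?_
    simp only [hsub]
    rw [intervalIntegral.integral_comp_sub_right fun u => h' (floorPt T u)]
    congr 1
    ring

lemma expAvg {M c : ℝ} (hc : 0 < c) (hT : IsTwoSided T) (hs : IsPeriodSeq T s)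
    (hh : Recurs T s h) (hm : Measurable fun u => h (floorPt T u)) (hM : ∀ t ∈ T, |h t| ≤ M) :
    Recurs T s (TimeScale.expAvg c fun u => h (floorPt T u)) := by
  obtain ⟨h', h1, h2⟩ := hh
  have hm' := measurable_limit hT hs hm h1
  have hM' := bdd_limit hs hM h1
  refine ⟨TimeScale.expAvg c fun u => h' (floorPt T u), fun t _ => ?_, fun t _ => ?_⟩
  · refine tendsto_expAvg hc (fun _ => hm) (fun _ u => hM _ (hT.floorPt_mem u)) fun v => ?_
    refine (h1 _ (hT.floorPt_mem (t - v))).congr fun j => ?_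
    rw [← hs.floorPt_add hT]
    congr 2
    ring
  · refine tendsto_expAvg hc (fun _ => hm') (fun _ u => hM' _ (hT.floorPt_mem u)) fun v => ?_
    refine (h2 _ (hT.floorPt_mem (t - v))).congr fun j => ?_
    rw [← hs.floorPt_sub hT]
    congr 2
    ring

/-- An ε/3 argument in each direction; the limits of the translates inherit the uniform error ε_j.
This makes the fixed-point set closed. -/
lemma of_uniform_limit {h : ℝ → ℝ} {H : ℕ → ℝ → ℝ} (hs : IsPeriodSeq T s)
    (hH : ∀ j, Recurs T s (H j)) {ε : ℕ → ℝ} (hε : Tendsto ε atTop (𝓝 0))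
    (hlim : ∀ j, ∀ t ∈ T, |H j t - h t| ≤ ε j) : Recurs T s h := by
  choose H' h1 h2 using hH
  have hsmall : ∀ η > 0, ∃ j, ε j < η := fun η hη => (hε.eventually_lt_const hη).exists
  have hex : ∀ t ∈ T, ∃ l, Tendsto (fun k => h (t + s k)) atTop (𝓝 l) := by
    intro t ht
    refine cauchySeq_tendsto_of_complete (Metric.cauchySeq_iff.2 fun η hη => ?_)
    obtain ⟨j, hj⟩ := hsmall (η / 3) (by positivity)
    obtain ⟨K, hK⟩ := Metric.cauchySeq_iff.1 (h1 j t ht).cauchySeq (η / 3) (by positivity)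
    refine ⟨K, fun p hp q hq => ?_⟩
    have e1 := hK p hp q hq
    have e2 := hlim j _ (hs p t ht).1
    have e3 := hlim j _ (hs q t ht).1
    rw [Real.dist_eq] at e1 ⊢
    rw [abs_lt] at e1 ⊢
    rw [abs_le] at e2 e3
    constructor <;> linarith [e2.1, e2.2, e3.1, e3.2]
  have hex' : ∀ t, ∃ l, t ∈ T → Tendsto (fun k => h (t + s k)) atTop (𝓝 l) := fun t => by
    by_cases ht : t ∈ T
    · exact (hex t ht).imp fun _ hl _ => hl
    · exact ⟨0, fun h => absurd h ht⟩
  choose h' h3 using hex'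
  have hclose : ∀ j, ∀ t ∈ T, |H' j t - h' t| ≤ ε j := fun j t ht =>
    le_of_tendsto ((h1 j t ht).sub (h3 t ht)).abs
      (Eventually.of_forall fun k => hlim j _ (hs k t ht).1)
  refine ⟨h', h3, fun t ht => Metric.tendsto_nhds.2 fun η hη => ?_⟩
  obtain ⟨j, hj⟩ := hsmall (η / 3) (by positivity)
  filter_upwards [Metric.tendsto_nhds.1 (h2 j t ht) (η / 3) (by positivity)] with k e1
  have e2 := hclose j _ (hs k t ht).2
  have e3 := hlim j t ht
  rw [Real.dist_eq] at e1 ⊢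
  rw [abs_lt] at e1 ⊢
  rw [abs_le] at e2 e3
  constructor <;> linarith [e2.1, e2.2, e3.1, e3.2]

end Recurs

/-- Finitely many almost automorphic functions recur along a common subsequence. -/
lemma exists_common_subseq {T : Set ℝ} (hne : T.Nonempty) (hc : (core T).Nonempty) {s : ℕ → ℝ}
    (hs : ∀ k, s k ∈ shifts T) {F : Set (ℝ → ℝ)} (hF : F.Finite)
    (haa : ∀ h ∈ F, AlmostAutomorphic T h) :
    ∃ θ : ℕ → ℕ, StrictMono θ ∧ ∀ h ∈ F, Recurs T (fun k => s (θ k)) h := by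
  induction F, hF using Set.Finite.induction_on with
  | empty => exact ⟨id, strictMono_id, fun h hh => absurd hh (notMem_empty h)⟩
  | @insert h F _ _ ih =>
    obtain ⟨θ, hθ, h1⟩ := ih fun k hk => haa k (mem_insert_of_mem _ hk)
    obtain ⟨κ, hκ, h', h2, h3⟩ := (haa h (mem_insert _ _)).2.2 (fun k => s (θ k))
      fun k => hs (θ k)
    rw [core_eq_of_nonempty hc hne] at h2 h3
    refine ⟨θ ∘ κ, hθ.comp hκ, fun k hk => ?_⟩
    rcases hk with rfl | hk
    · exact ⟨h', h2, h3⟩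
    · exact (h1 k hk).comp_strictMono hκ

lemma HasDeltaDerivAt.sub {T : Set ℝ} {f g : ℝ → ℝ} {d e t : ℝ} (hf : HasDeltaDerivAt T f d t)
    (hg : HasDeltaDerivAt T g e t) : HasDeltaDerivAt T (fun s => f s - g s) (d - e) t := by
  intro ε hε
  filter_upwards [hf (ε / 2) (half_pos hε), hg (ε / 2) (half_pos hε)] with s h1 h2
  calc _ = |(f (sigma T t) - f s - d * (sigma T t - s)) -
        (g (sigma T t) - g s - e * (sigma T t - s))| := by congr 1; ring
    _ ≤ _ := (abs_sub _ _).trans (by linarith)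

/-! ### The pointwise contraction -/

/-- The factor by which a step with decay `κ ≤ c` contracts, for decay rates in
`[a₀, 4 κ / (3 + q)]` and perturbations of relative size `q`. -/
def contractionFactor (q a₀ c : ℝ) : ℝ := max (1 - (1 - q) * a₀ / c) ((1 + 3 * q) / (3 + q))

lemma contractionFactor_lt_one {q a₀ c : ℝ} (hq : 0 ≤ q) (hq1 : q < 1) (ha : 0 < a₀)
    (hc : 0 < c) : contractionFactor q a₀ c < 1 := by
  refine max_lt ?_ ?_
  · have : 0 < (1 - q) * a₀ / c := div_pos (mul_pos (by linarith) ha) hc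
    linarith
  · rw [div_lt_one (by linarith)]
    linarith

lemma contractionFactor_nonneg {q : ℝ} (a₀ c : ℝ) (hq : 0 ≤ q) : 0 ≤ contractionFactor q a₀ c :=
  le_max_of_le_right (by positivity)

/-- The expression is ((κ - a) x + e)/κ, of size at most (|κ - a| + q a) D/κ. If a ≤ κ this factor
is 1 - (1 - q) a/κ, handled by a ≥ a₀ and κ ≤ c. If a ≥ κ it is (1 + q) a/κ - 1 ≤ 4(1 + q)/(3 + q) -
1 = (1 + 3q)/(3 + q). -/
lemma abs_step_le {q a₀ c κ a x e D : ℝ} (hq : 0 ≤ q) (hq1 : q < 1) (hκ : 0 < κ)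
    (hκc : κ ≤ c) (ha₀ : 0 < a₀) (ha : a₀ ≤ a) (haκ : a * ((3 + q) / 4) ≤ κ) (hx : |x| ≤ D)
    (he : |e| ≤ q * a * D) : |x + (-a * x + e) / κ| ≤ contractionFactor q a₀ c * D := by
  have hD : 0 ≤ D := (abs_nonneg x).trans hx
  have hc : 0 < c := hκ.trans_le hκc
  have h1 : x + (-a * x + e) / κ = ((κ - a) * x + e) / κ := by field_simp; ring
  rw [h1, abs_div, abs_of_pos hκ, div_le_iff₀ hκ]
  have h2 : |(κ - a) * x + e| ≤ (|κ - a| + q * a) * D := by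
    refine (abs_add_le _ _).trans ?_
    rw [abs_mul, add_mul]
    gcongr
  refine h2.trans ?_
  rw [mul_right_comm]
  refine mul_le_mul_of_nonneg_right ?_ hD
  rcases le_total a κ with h | h
  · rw [abs_of_nonneg (sub_nonneg.2 h)]
    refine le_trans ?_ (mul_le_mul_of_nonneg_right (le_max_left _ _) hκ.le)
    have h3 : (1 - q) * a₀ / c * κ ≤ (1 - q) * a := by
      rw [div_mul_eq_mul_div, div_le_iff₀ hc]
      have h4 : 0 ≤ 1 - q := by linarith
      exact mul_le_mul (mul_le_mul_of_nonneg_left ha h4) hκc hκ.le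
        (mul_nonneg h4 (ha₀.le.trans ha))
    linarith
  · rw [abs_of_nonpos (sub_nonpos.2 h)]
    refine le_trans ?_ (mul_le_mul_of_nonneg_right (le_max_right _ _) hκ.le)
    rw [div_mul_eq_mul_div, le_div_iff₀ (by linarith)]
    nlinarith

/-! ### The fixed-point operator and its solutions -/

namespace Network

variable {m n : ℕ}

/-- All almost automorphic coefficients of the network. -/
def coefficients (N : Network m n) : Set (ℝ → ℝ) :=
  range (fun c : Fin m × Fin n => N.a c.1 c.2) ∪ range (fun c : Fin m × Fin n => N.L c.1 c.2) ∪
  range (fun c : Fin m × Fin n => N.τ c.1 c.2) ∪ range (fun c : Fin m × Fin n => N.δ c.1 c.2) ∪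
  range (fun c : (Fin m × Fin n) × Fin m × Fin n => N.B c.1.1 c.1.2 c.2.1 c.2.2) ∪
  range (fun c : (Fin m × Fin n) × Fin m × Fin n => N.C c.1.1 c.1.2 c.2.1 c.2.2)

lemma finite_coefficients (N : Network m n) : N.coefficients.Finite :=
  (((((finite_range _).union (finite_range _)).union (finite_range _)).union
    (finite_range _)).union (finite_range _)).union (finite_range _)

/-- `c` is a decay for which exponential averaging contracts with factor `θ`. -/
structure IsContractive (N : Network m n) (T : Set ℝ) (ρ Mf Lf Mg Lg c q θ : ℝ) : Prop where
  c_pos : 0 < c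
  θ_nonneg : 0 ≤ θ
  θ_lt : θ < 1
  decay_pos : ∀ t ∈ T, 0 < decayRate c (graininess T t)
  bound_le : ∀ i j, N.forcingBound T ρ Mf Mg i j ≤ q * infVal T (N.a i j) * ρ
  lip_le : ∀ i j, N.forcingLip T ρ Mf Lf Mg Lg i j ≤ q * infVal T (N.a i j)
  step : ∀ i j, ∀ t ∈ T, ∀ x e D : ℝ, |x| ≤ D → |e| ≤ q * infVal T (N.a i j) * D →
    |x + (-(N.a i j t) * x + e) / decayRate c (graininess T t)| ≤ θ * D

/-- The exponential average of the target of `x`. -/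
def targetAverage (N : Network m n) (T : Set ℝ) (c : ℝ)
    (x : ℝ → Fin m → Fin n → ℝ) (t : ℝ) (i : Fin m) (j : Fin n) : ℝ :=
  expAvg c (fun u => N.target T c x i j (floorPt T u)) t

namespace Admissible

variable {N : Network m n} {T : Set ℝ} {ρ Mf Lf Mg Lg : ℝ}

lemma exists_isContractive (hN : N.Admissible T ρ Mf Lf Mg Lg) (hT : IsTwoSided T) (hm : 0 < m)
    (hn : 0 < n) (h_ball : ∀ i j, N.forcingBound T ρ Mf Mg i j / infVal T (N.a i j) < ρ)
    (h_contr : ∀ i j, N.forcingLip T ρ Mf Lf Mg Lg i j / infVal T (N.a i j) < 1) :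
    ∃ c q θ, N.IsContractive T ρ Mf Lf Mg Lg c q θ := by
  have hlim : ∀ y : ℝ, Tendsto (fun q : ℝ => q * y) (𝓝[<] 1) (𝓝 y) := fun y => by
    simpa using ((tendsto_id (x := 𝓝 (1 : ℝ))).mul_const y).mono_left nhdsWithin_le_nhds
  -- Finitely many strict inequalities leave room for a common q < 1.
  have hq : ∀ᶠ q : ℝ in 𝓝[<] 1, (∀ i j, N.forcingBound T ρ Mf Mg i j ≤ q * infVal T (N.a i j) * ρ) ∧
      (∀ i j, N.forcingLip T ρ Mf Lf Mg Lg i j ≤ q * infVal T (N.a i j)) ∧ q ∈ Ioo (0 : ℝ) 1 := by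
    refine Eventually.and (eventually_all.2 fun i => eventually_all.2 fun j => ?_)
      (Eventually.and (eventually_all.2 fun i => eventually_all.2 fun j => ?_)
        (Ioo_mem_nhdsLT one_pos))
    · have h := h_ball i j
      rw [div_lt_iff₀ (hN.a_pos i j), mul_comm] at h
      filter_upwards [(hlim _).eventually_const_lt h] with q hq
      rw [mul_assoc]
      exact hq.le
    · have h := h_contr i j
      rw [div_lt_one (hN.a_pos i j)] at h
      filter_upwards [(hlim _).eventually_const_lt h] with q hq using hq.le
  obtain ⟨q, hq1, hq2, hq0, hq3⟩ := hq.exists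
  have hK : ∀ᶠ K : ℝ in atTop, 0 < K ∧ ∀ i j, ∀ t ∈ T, N.a i j t ≤ K := by
    refine (eventually_gt_atTop 0).and (eventually_all.2 fun i => eventually_all.2 fun j => ?_)
    filter_upwards [eventually_ge_atTop (supNorm T (N.a i j))] with K hK t ht
    exact (le_abs_self _).trans (((hN.aa_a i j).abs_le_supNorm ht).trans hK)
  obtain ⟨K, hK0, hK⟩ := hK.exists
  have ha₀ : ∀ᶠ a₀ : ℝ in 𝓝[>] 0, 0 < a₀ ∧ ∀ i j, a₀ ≤ infVal T (N.a i j) := by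
    refine (eventually_mem_nhdsWithin).and (eventually_all.2 fun i => eventually_all.2 fun j => ?_)
    filter_upwards [Ioo_mem_nhdsGT (hN.a_pos i j)] with y hy using hy.2.le
  obtain ⟨a₀, ha₀, ha₀'⟩ := ha₀.exists
  -- Chosen so that 1 - e^{-c/K} = (3 + q)/4, the midpoint of (1 + q)/2 and 1: above the contraction
  -- threshold, yet below the limit set by μ a < 1.
  set c := K * -Real.log ((1 - q) / 4) with hcdef
  have hc : 0 < c :=
    mul_pos hK0 (neg_pos.2 (Real.log_neg (by linarith) (by linarith)))
  have hexp : 1 - Real.exp (-(c / K)) = (3 + q) / 4 := by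
    rw [hcdef, mul_div_cancel_left₀ _ hK0.ne', neg_neg, Real.exp_log (by linarith)]
    ring
  have hκ : ∀ i j, ∀ t ∈ T, N.a i j t * ((3 + q) / 4) ≤ decayRate c (graininess T t) :=
    fun i j t ht => hexp ▸ mul_le_decayRate hc.le hK0
      ((hN.a_pos i j).le.trans ((hN.aa_a i j).infVal_le ht)) (hK i j t ht)
      (hT.graininess_nonneg t) (hN.regressive i j t ht).le
  have hpos : ∀ t ∈ T, 0 < decayRate c (graininess T t) := fun t ht =>
    (mul_pos ((hN.a_pos ⟨0, hm⟩ ⟨0, hn⟩).trans_le ((hN.aa_a _ _).infVal_le ht))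
      (by linarith)).trans_le (hκ _ _ t ht)
  refine ⟨c, q, contractionFactor q a₀ c, hc, contractionFactor_nonneg _ _ hq0.le,
    contractionFactor_lt_one hq0.le hq3 ha₀ hc, hpos, hq1, hq2, fun i j t ht x e D hx he => ?_⟩
  have hinf := (hN.aa_a i j).infVal_le ht
  have hD : 0 ≤ D := (abs_nonneg x).trans hx
  refine abs_step_le hq0.le hq3 (hpos t ht) (decayRate_le (hT.graininess_nonneg t)) ha₀
    ((ha₀' i j).trans hinf) (hκ i j t ht) hx (he.trans ?_)
  gcongr

lemma recurs_target (hN : N.Admissible T ρ Mf Lf Mg Lg) (hT : IsTwoSided T) {s : ℕ → ℝ}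
    (hs : IsPeriodSeq T s) (hdata : ∀ h ∈ N.coefficients, Recurs T s h)
    {x : ℝ → Fin m → Fin n → ℝ} (hx : IsState T ρ x) {K : ℝ}
    (hlip : ∀ i j, ∀ u ∈ T, ∀ v ∈ T, |x u i j - x v i j| ≤ K * |u - v|)
    (hrec : ∀ i j, Recurs T s fun t => x t i j) (c : ℝ) (i : Fin m) (j : Fin n) :
    Recurs T s (N.target T c x i j) := by
  have ha : ∀ i j, Recurs T s (N.a i j) := fun i j =>
    hdata _ (.inl (.inl (.inl (.inl (.inl ⟨(i, j), rfl⟩)))))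
  have hL : ∀ i j, Recurs T s (N.L i j) := fun i j =>
    hdata _ (.inl (.inl (.inl (.inl (.inr ⟨(i, j), rfl⟩)))))
  have hτ : ∀ i j, Recurs T s (N.τ i j) := fun i j =>
    hdata _ (.inl (.inl (.inl (.inr ⟨(i, j), rfl⟩))))
  have hδ : ∀ i j, Recurs T s (N.δ i j) := fun i j => hdata _ (.inl (.inl (.inr ⟨(i, j), rfl⟩)))
  have hB : ∀ i j k l, Recurs T s (N.B i j k l) := fun i j k l =>
    hdata _ (.inl (.inr ⟨((i, j), k, l), rfl⟩))
  have hC : ∀ i j k l, Recurs T s (N.C i j k l) := fun i j k l =>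
    hdata _ (.inr ⟨((i, j), k, l), rfl⟩)
  -- Periods preserve the graininess, hence the decay rate.
  have hκ : Recurs T s fun t => (decayRate c (graininess T t))⁻¹ :=
    .of_invariant (fun k t => by rw [hs.graininess_add hT])
      (fun k t => by rw [hs.graininess_sub hT])
  have hinh : Recurs T s (N.inhibition T x i j) := by
    refine .add (.sum fun d => ?_) (.sum fun d => ?_)
    · exact (hB i j d.1 d.2).mul (.comp_continuous hN.f_cont
        ((hrec d.1 d.2).delay hT.closed hs (hlip d.1 d.2) (hτ d.1 d.2) (hN.τ_mem d.1 d.2)))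
    · exact (hC i j d.1 d.2).mul (.deltaIntegral hT hs
        ((hrec d.1 d.2).comp_continuous hN.g_cont)
        ((hN.rightDenseCont_g hx d.1 d.2).measurable_comp_floorPt hT)
        (fun t ht => hN.g_le _ (hx.le t ht d.1 d.2)) (hδ d.1 d.2) (hN.δ_mem d.1 d.2))
  have hfor : Recurs T s (N.forcing T x i j) := (hL i j).sub (hinh.mul (hrec i j))
  simpa only [target, div_eq_mul_inv] using! (hrec i j).add (((((ha i j).comp_continuous
    continuous_neg).mul (hrec i j)).add hfor).mul hκ)

variable {c q θ : ℝ}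

lemma abs_target_le (hN : N.Admissible T ρ Mf Lf Mg Lg) (hT : IsTwoSided T)
    (hc : N.IsContractive T ρ Mf Lf Mg Lg c q θ) {x : ℝ → Fin m → Fin n → ℝ}
    (hx : IsState T ρ x) {t : ℝ} (ht : t ∈ T) (i : Fin m) (j : Fin n) :
    |N.target T c x i j t| ≤ ρ :=
  (hc.step i j t ht _ _ _ (hx.le t ht i j)
    ((hN.abs_forcing_le hT hx ht i j).trans (hc.bound_le i j))).trans
    (mul_le_of_le_one_left hN.rho_nonneg hc.θ_lt.le)

lemma abs_target_sub_le (hN : N.Admissible T ρ Mf Lf Mg Lg) (hT : IsTwoSided T)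
    (hc : N.IsContractive T ρ Mf Lf Mg Lg c q θ) {x y : ℝ → Fin m → Fin n → ℝ}
    (hx : IsState T ρ x) (hy : IsState T ρ y) {D : ℝ}
    (hD : ∀ t ∈ T, ∀ i j, |x t i j - y t i j| ≤ D) {t : ℝ} (ht : t ∈ T) (i : Fin m) (j : Fin n) :
    |N.target T c x i j t - N.target T c y i j t| ≤ θ * D := by
  have hD0 : 0 ≤ D := (abs_nonneg _).trans (hD t ht i j)
  have h := hc.step i j t ht _ _ D (hD t ht i j) ((hN.abs_forcing_sub_le hT hx hy hD ht i j).trans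
    (mul_le_mul_of_nonneg_right (hc.lip_le i j) hD0))
  convert h using 2
  rw [target, target]
  ring

lemma measurable_target (hN : N.Admissible T ρ Mf Lf Mg Lg) (hT : IsTwoSided T)
    (hc : N.IsContractive T ρ Mf Lf Mg Lg c q θ) {x : ℝ → Fin m → Fin n → ℝ}
    (hx : IsState T ρ x) (i : Fin m) (j : Fin n) :
    Measurable fun u => N.target T c x i j (floorPt T u) :=
  (hN.rightDenseCont_target hT hx (fun t ht => (hc.decay_pos t ht).ne') i j).measurable_comp_floorPt
    hT

lemma abs_average_le (hN : N.Admissible T ρ Mf Lf Mg Lg) (hT : IsTwoSided T)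
    (hc : N.IsContractive T ρ Mf Lf Mg Lg c q θ) {x : ℝ → Fin m → Fin n → ℝ}
    (hx : IsState T ρ x) (t : ℝ) (i : Fin m) (j : Fin n) : |N.targetAverage T c x t i j| ≤ ρ :=
  abs_expAvg_le hc.c_pos (fun u => hN.abs_target_le hT hc hx (hT.floorPt_mem u) i j) t

lemma abs_average_sub_average_le (hN : N.Admissible T ρ Mf Lf Mg Lg) (hT : IsTwoSided T)
    (hc : N.IsContractive T ρ Mf Lf Mg Lg c q θ) {x : ℝ → Fin m → Fin n → ℝ}
    (hx : IsState T ρ x) (i : Fin m) (j : Fin n) (u v : ℝ) :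
    |N.targetAverage T c x u i j - N.targetAverage T c x v i j| ≤ 2 * ρ * c * |u - v| :=
  abs_expAvg_sub_le hc.c_pos (hN.measurable_target hT hc hx i j)
    (fun u => hN.abs_target_le hT hc hx (hT.floorPt_mem u) i j) v u

lemma abs_average_sub_le (hN : N.Admissible T ρ Mf Lf Mg Lg) (hT : IsTwoSided T)
    (hc : N.IsContractive T ρ Mf Lf Mg Lg c q θ) {x y : ℝ → Fin m → Fin n → ℝ}
    (hx : IsState T ρ x) (hy : IsState T ρ y) {D : ℝ}
    (hD : ∀ t ∈ T, ∀ i j, |x t i j - y t i j| ≤ D) (t : ℝ) (i : Fin m) (j : Fin n) :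
    |N.targetAverage T c x t i j - N.targetAverage T c y t i j| ≤ θ * D := by
  rw [targetAverage, targetAverage, expAvg_sub hc.c_pos (hN.measurable_target hT hc hx i j)
    (hN.measurable_target hT hc hy i j)
    (fun u => hN.abs_target_le hT hc hx (hT.floorPt_mem u) i j)
    (fun u => hN.abs_target_le hT hc hy (hT.floorPt_mem u) i j)]
  exact abs_expAvg_le hc.c_pos
    (fun u => hN.abs_target_sub_le hT hc hx hy hD (hT.floorPt_mem u) i j) t

/-- Serves both directions: the last term vanishes at a fixed point, and subtracting the identity
from the network equation leaves d^Δ = -κ d for the difference. -/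
lemma hasDeltaDerivAt_average (hN : N.Admissible T ρ Mf Lf Mg Lg) (hT : IsTwoSided T)
    (hc : N.IsContractive T ρ Mf Lf Mg Lg c q θ) {x : ℝ → Fin m → Fin n → ℝ}
    (hx : IsState T ρ x) {t : ℝ} (ht : t ∈ T) (i : Fin m) (j : Fin n) :
    HasDeltaDerivAt T (fun s => N.targetAverage T c x s i j) (-(N.a i j t) * x t i j +
      N.forcing T x i j t +
        decayRate c (graininess T t) * (x t i j - N.targetAverage T c x t i j)) t := by
  have h := hasDeltaDerivAt_expAvg hT hc.c_pos (hN.rightDenseCont_target hT hx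
    (fun t ht => (hc.decay_pos t ht).ne') i j) (fun t ht => hN.abs_target_le hT hc hx ht i j) ht
  have h0 := (hc.decay_pos t ht).ne'
  have heq : -(N.a i j t) * x t i j + N.forcing T x i j t +
      decayRate c (graininess T t) * (x t i j - N.targetAverage T c x t i j) =
      decayRate c (graininess T t) * (N.target T c x i j t - N.targetAverage T c x t i j) := by
    rw [target]
    field_simp
    ring
  rw [heq]
  exact h

/-- A bounded solution is the exponential average of its target. -/
lemma eqOn_average (hN : N.Admissible T ρ Mf Lf Mg Lg) (hT : IsTwoSided T)
    (hc : N.IsContractive T ρ Mf Lf Mg Lg c q θ) {x : ℝ → Fin m → Fin n → ℝ}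
    (hx : IsState T ρ x)
    (hsol : IsSICNNSolution T N.r N.p N.a N.L N.τ N.δ N.B N.C N.f N.g x) {t : ℝ} (ht : t ∈ T)
    (i : Fin m) (j : Fin n) : x t i j = N.targetAverage T c x t i j := by
  refine sub_eq_zero.1 (eq_zero_of_hasDeltaDerivAt (M := ρ + ρ) hT hc.c_pos
    (d := fun t => x t i j - N.targetAverage T c x t i j) (fun t ht => ?_) (fun t ht => ?_) ht)
  · convert ((N.isSICNNSolution_iff).1 hsol t ht i j).sub
      (hN.hasDeltaDerivAt_average hT hc hx ht i j) using 1
    ring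
  · exact (abs_sub _ _).trans (add_le_add (hx.le t ht i j) (hN.abs_average_le hT hc hx t i j))

lemma isState_of_solution (hT : IsTwoSided T) {x : ℝ → Fin m → Fin n → ℝ}
    (haa : AlmostAutomorphic T x) (hle : supNorm T x ≤ ρ)
    (hsol : IsSICNNSolution T N.r N.p N.a N.L N.τ N.δ N.B N.C N.f N.g x) : IsState T ρ x where
  cont i j t ht := ((N.isSICNNSolution_iff).1 hsol t ht i j).continuousWithinAt hT ht
  le t ht i j := ((norm_le_pi_norm (x t i) j).trans (norm_le_pi_norm (x t) i)).trans
    ((haa.norm_le_supNorm ht).trans hle)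

/-- Both solutions are averages of their targets, so any bound D on their distance improves to θ D;
the iteration starts from 2ρ. -/
lemma eqOn_of_solution (hN : N.Admissible T ρ Mf Lf Mg Lg) (hT : IsTwoSided T)
    (hc : N.IsContractive T ρ Mf Lf Mg Lg c q θ) {x y : ℝ → Fin m → Fin n → ℝ}
    (hx : IsState T ρ x) (hy : IsState T ρ y)
    (hxsol : IsSICNNSolution T N.r N.p N.a N.L N.τ N.δ N.B N.C N.f N.g x)
    (hysol : IsSICNNSolution T N.r N.p N.a N.L N.τ N.δ N.B N.C N.f N.g y) : EqOn x y T := by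
  set S : Set ℝ := {D | 0 ≤ D ∧ ∀ t ∈ T, ∀ i j, |x t i j - y t i j| ≤ D} with hS
  have hpow : ∀ k : ℕ, θ ^ k * (ρ + ρ) ∈ S := by
    intro k
    induction k with
    | zero =>
      refine ⟨by linarith [hN.rho_nonneg], fun t ht i j => ?_⟩
      rw [pow_zero, one_mul]
      exact (abs_sub _ _).trans (add_le_add (hx.le t ht i j) (hy.le t ht i j))
    | succ k ih =>
      rw [pow_succ', mul_assoc]
      refine ⟨mul_nonneg hc.θ_nonneg ih.1, fun t ht i j => ?_⟩
      rw [hN.eqOn_average hT hc hx hxsol ht, hN.eqOn_average hT hc hy hysol ht]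
      exact hN.abs_average_sub_le hT hc hx hy ih.2 t i j
  have hlim : Tendsto (fun k : ℕ => θ ^ k * (ρ + ρ)) atTop (𝓝 (0 * (ρ + ρ))) :=
    (tendsto_pow_atTop_nhds_zero_of_lt_one hc.θ_nonneg hc.θ_lt).mul_const _
  rw [zero_mul] at hlim
  intro t ht
  funext i j
  refine sub_eq_zero.1 (abs_nonpos_iff.1 (ge_of_tendsto' hlim fun k => (hpow k).2 t ht i j))

open BoundedContinuousFunction in
-- Recurrence is required along every period sequence on which all coefficients recur. The sequence
-- is thus fixed independently of the iterate, so the condition is stable under the operator and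
-- under uniform limits. The Lipschitz bound 2ρc is included because recurrence of the delayed terms
-- needs it.
lemma exists_fixedPoint (hN : N.Admissible T ρ Mf Lf Mg Lg) (hT : IsTwoSided T)
    (hc : N.IsContractive T ρ Mf Lf Mg Lg c q θ) :
    ∃ x : ℝ → Fin m → Fin n → ℝ, Continuous x ∧ IsState T ρ x ∧
      (∀ s, IsPeriodSeq T s → (∀ h ∈ N.coefficients, Recurs T s h) →
        ∀ i j, Recurs T s fun t => x t i j) ∧ x = N.targetAverage T c x := by
  set S : Set (ℝ →ᵇ (Fin m → Fin n → ℝ)) := {x | (∀ t i j, |x t i j| ≤ ρ) ∧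
    (∀ i j u v, |x u i j - x v i j| ≤ 2 * ρ * c * |u - v|) ∧
    ∀ s, IsPeriodSeq T s → (∀ h ∈ N.coefficients, Recurs T s h) →
      ∀ i j, Recurs T s fun t => x t i j} with hS
  have hdist : ∀ (x y : ℝ →ᵇ (Fin m → Fin n → ℝ)) t i j, |x t i j - y t i j| ≤ dist x y :=
    fun x y t i j => (dist_le_pi_dist (x t i) (y t i) j).trans
      ((dist_le_pi_dist (x t) (y t) i).trans (dist_coe_le_dist t))
  have hstate : ∀ x ∈ S, IsState T ρ x := fun x hx =>
    ⟨fun i j => ((continuous_apply_apply i j).comp x.continuous).continuousOn,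
      fun t _ i j => hx.1 t i j⟩
  have hclosed : IsClosed S := by
    refine IsSeqClosed.isClosed fun X x hX hlim => ?_
    have hd : Tendsto (fun k => dist (X k) x) atTop (𝓝 0) := tendsto_iff_dist_tendsto_zero.1 hlim
    have hpt : ∀ t i j, Tendsto (fun k => X k t i j) atTop (𝓝 (x t i j)) := fun t i j =>
      tendsto_iff_dist_tendsto_zero.2 (squeeze_zero (fun _ => dist_nonneg)
        (fun k => hdist (X k) x t i j) hd)
    refine ⟨fun t i j => le_of_tendsto' (hpt t i j).abs fun k => (hX k).1 t i j,
      fun i j u v => le_of_tendsto' ((hpt u i j).sub (hpt v i j)).abs fun k => (hX k).2.1 i j u v,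
      fun s hs hdata i j => Recurs.of_uniform_limit hs (fun k => (hX k).2.2 s hs hdata i j) hd
        fun k t _ => hdist (X k) x t i j⟩
  have hstep : ∀ x : S, ∃ y : S, ∀ t, y.1 t = N.targetAverage T c x.1 t := by
    rintro ⟨x, hx⟩
    have hxs := hstate x hx
    have hcont : Continuous (N.targetAverage T c x) := by
      refine continuous_pi fun i => continuous_pi fun j => ?_
      refine LipschitzWith.continuous (K := (2 * ρ * c).toNNReal) (LipschitzWith.of_dist_le_mul
        fun u v => ?_)
      rw [Real.coe_toNNReal _ (by have := hN.rho_nonneg; have := hc.c_pos; positivity)]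
      exact hN.abs_average_sub_average_le hT hc hxs i j u v
    refine ⟨⟨.ofNormedAddCommGroup (N.targetAverage T c x) hcont ρ fun t => ?_, ?_⟩, fun t => rfl⟩
    · exact (pi_norm_le_iff_of_nonneg hN.rho_nonneg).2 fun i =>
        (pi_norm_le_iff_of_nonneg hN.rho_nonneg).2 fun j => hN.abs_average_le hT hc hxs t i j
    · exact ⟨hN.abs_average_le hT hc hxs, hN.abs_average_sub_average_le hT hc hxs,
        fun s hs hdata i j => Recurs.expAvg hc.c_pos hT hs
          (hN.recurs_target hT hs hdata hxs (fun i j u _ v _ => hx.2.1 i j u v)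
            (hx.2.2 s hs hdata) c i j) (hN.measurable_target hT hc hxs i j)
          fun t ht => hN.abs_target_le hT hc hxs ht i j⟩
  choose Φ hΦ using hstep
  have hcontr : ContractingWith ⟨θ, hc.θ_nonneg⟩ Φ := by
    refine ⟨hc.θ_lt, LipschitzWith.of_dist_le_mul fun x y => ?_⟩
    have h0 : 0 ≤ θ * dist x y := mul_nonneg hc.θ_nonneg dist_nonneg
    refine (BoundedContinuousFunction.dist_le h0).2 fun t => (dist_pi_le_iff h0).2 fun i =>
      (dist_pi_le_iff h0).2 fun j => ?_
    rw [hΦ, hΦ]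
    exact hN.abs_average_sub_le hT hc (hstate _ x.2) (hstate _ y.2)
      (fun t _ i j => hdist x.1 y.1 t i j) t i j
  have : CompleteSpace S := hclosed.completeSpace_coe
  have : Nonempty S := by
    have hρ := hN.rho_nonneg
    have hc0 := hc.c_pos
    refine ⟨0, fun t i j => by simpa using hρ, fun i j u v => ?_,
      fun s _ _ i j => Recurs.const 0⟩
    simp only [coe_zero, Pi.zero_apply, sub_self, abs_zero]
    positivity
  have hfix := hcontr.fixedPoint_isFixedPt
  set x := hcontr.fixedPoint Φ
  refine ⟨x.1, x.1.continuous, hstate _ x.2, x.2.2.2, funext fun t => ?_⟩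
  rw [← hΦ x t, hfix]

lemma exists_solution (hN : N.Admissible T ρ Mf Lf Mg Lg) (hT : IsTwoSided T)
    (hc : N.IsContractive T ρ Mf Lf Mg Lg c q θ) :
    ∃ x : ℝ → Fin m → Fin n → ℝ, AlmostAutomorphic T x ∧ supNorm T x ≤ ρ ∧
      IsSICNNSolution T N.r N.p N.a N.L N.τ N.δ N.B N.C N.f N.g x := by
  obtain ⟨x, hcont, hx, hrec, hfix⟩ := hN.exists_fixedPoint hT hc
  have hne : T.Nonempty := (hT.below 0).mono inter_subset_left
  have hbound : ∀ t ∈ T, ‖x t‖ ≤ ρ := fun t ht =>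
    (pi_norm_le_iff_of_nonneg hN.rho_nonneg).2 fun i =>
      (pi_norm_le_iff_of_nonneg hN.rho_nonneg).2 fun j => hx.le t ht i j
  refine ⟨x, ⟨⟨ρ, hbound⟩, ⟨fun t _ => hcont.continuousWithinAt,
    fun t _ => ⟨x t, (hcont.tendsto t).mono_left nhdsWithin_le_nhds⟩⟩, fun s hs => ?_⟩,
    csSup_le (hne.image _) ?_, ?_⟩
  · by_cases hcore : (core T).Nonempty
    · obtain ⟨θ, hθ, hdata⟩ := exists_common_subseq hne hcore hs N.finite_coefficients (by
        rintro h (((((⟨d, rfl⟩ | ⟨d, rfl⟩) | ⟨d, rfl⟩) | ⟨d, rfl⟩) | ⟨d, rfl⟩) | ⟨d, rfl⟩)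
        exacts [hN.aa_a _ _, hN.aa_L _ _, hN.aa_τ _ _, hN.aa_δ _ _, hN.aa_B _ _ _ _,
          hN.aa_C _ _ _ _])
      choose x' h1 h2 using hrec _ ((isPeriodSeq_of_core_nonempty hcore hs).comp θ) hdata
      exact ⟨θ, hθ, fun t i j => x' i j t,
        fun t ht => tendsto_pi_nhds.2 fun i => tendsto_pi_nhds.2 fun j =>
          h1 i j t (core_subset hne ht),
        fun t ht => tendsto_pi_nhds.2 fun i => tendsto_pi_nhds.2 fun j =>
          h2 i j t (core_subset hne ht)⟩
    -- With an empty core the convergence conditions are vacuous and any subsequence serves.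
    · rw [not_nonempty_iff_eq_empty] at hcore
      simp only [hcore, mem_empty_iff_false, false_implies, implies_true, and_true, exists_const]
      exact ⟨id, strictMono_id⟩
  · rintro _ ⟨t, ht, rfl⟩
    exact hbound t ht
  · refine (N.isSICNNSolution_iff).2 fun t ht i j => ?_
    have h := hN.hasDeltaDerivAt_average hT hc hx ht i j
    rwa [← hfix, sub_self, mul_zero, add_zero] at h

end Admissible

end Network

/-! ### Reduction of the hypotheses to the contractive setting -/

/-- On the ρ-ball both growth conditions yield the same bound M ρ, the only one the estimates need;
for the constant bound, ρ ≥ 1 gives M ≤ M ρ. -/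
lemma abs_le_mul_of_bound {φ : ℝ → ℝ} {M ρ : ℝ} (hM : 0 ≤ M)
    (h : (∀ u, |φ u| ≤ M * |u|) ∨ (1 ≤ ρ ∧ ∀ u, |φ u| ≤ M)) (u : ℝ) (hu : |u| ≤ ρ) :
    |φ u| ≤ M * ρ := by
  rcases h with h | ⟨h1, h2⟩
  · exact (h u).trans (mul_le_mul_of_nonneg_left hu hM)
  · exact (h2 u).trans (le_mul_of_one_le_right hM h1)

/-- The sign of ρ is not assumed: ρ enters the left side only squared, so that side is nonnegative
and lies below ρ. -/
lemma Network.rho_nonneg_of_forcingBound {m n : ℕ} (N : Network m n) {T : Set ℝ} {ρ Mf Mg : ℝ}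
    (hMf : 0 ≤ Mf) (hMg : 0 ≤ Mg) (hm : 0 < m) (hn : 0 < n)
    (ha : ∀ i j, 0 < infVal T (N.a i j))
    (h : ∀ i j, N.forcingBound T ρ Mf Mg i j / infVal T (N.a i j) < ρ) : 0 ≤ ρ := by
  refine le_trans (div_nonneg (add_nonneg (add_nonneg (Finset.sum_nonneg fun c _ => ?_)
    (Finset.sum_nonneg fun c _ => ?_)) (supNorm_nonneg _ _)) (ha _ _).le) (h ⟨0, hm⟩ ⟨0, hn⟩).le
  · exact mul_nonneg (mul_nonneg (supNorm_nonneg _ _) hMf) (sq_nonneg _)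
  · exact mul_nonneg (mul_nonneg (mul_nonneg (supNorm_nonneg _ _) hMg) (supNorm_nonneg _ _))
      (sq_nonneg _)

/-- A contractive network has exactly one almost automorphic solution bounded by `ρ`. -/
lemma Network.Admissible.exists_eqOn_solution {m n : ℕ} {N : Network m n} {T : Set ℝ}
    {ρ Mf Lf Mg Lg : ℝ} (hN : N.Admissible T ρ Mf Lf Mg Lg) (hT : IsTwoSided T) (hm : 0 < m)
    (hn : 0 < n) (h_ball : ∀ i j, N.forcingBound T ρ Mf Mg i j / infVal T (N.a i j) < ρ)
    (h_contr : ∀ i j, N.forcingLip T ρ Mf Lf Mg Lg i j / infVal T (N.a i j) < 1) :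
    ∃ x : ℝ → Fin m → Fin n → ℝ,
      (AlmostAutomorphic T x ∧ supNorm T x ≤ ρ ∧
        IsSICNNSolution T N.r N.p N.a N.L N.τ N.δ N.B N.C N.f N.g x) ∧
      ∀ y : ℝ → Fin m → Fin n → ℝ,
        AlmostAutomorphic T y → supNorm T y ≤ ρ →
        IsSICNNSolution T N.r N.p N.a N.L N.τ N.δ N.B N.C N.f N.g y → EqOn y x T := by
  obtain ⟨c, q, θ, hc⟩ := hN.exists_isContractive hT hm hn h_ball h_contr
  obtain ⟨x, hx, hxρ, hxsol⟩ := hN.exists_solution hT hc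
  exact ⟨x, ⟨hx, hxρ, hxsol⟩, fun y hy hyρ hysol => hN.eqOn_of_solution hT hc
    (Network.Admissible.isState_of_solution hT hy hyρ hysol)
    (Network.Admissible.isState_of_solution hT hx hxρ hxsol) hysol hxsol⟩

end TimeScale

end

theorem theorem5p1
    (T : Set ℝ) (hT : TimeScale.IsAlmostPeriodic T)
    (m n : ℕ) (hm : 0 < m) (hn : 0 < n) (r p : ℕ)
    (a L τ δ : Fin m → Fin n → ℝ → ℝ)
    (B C : Fin m → Fin n → Fin m → Fin n → ℝ → ℝ)
    (f g : ℝ → ℝ) (Lf Lg Mf Mg ρ : ℝ)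
    -- standing assumptions on the network
    (ha_inf : ∀ i j, 0 < TimeScale.infVal T (a i j))
    (hB_nonneg : ∀ i j k l, ∀ t ∈ T, 0 ≤ B i j k l t)
    (hC_nonneg : ∀ i j k l, ∀ t ∈ T, 0 ≤ C i j k l t)
    (hτ_mem : ∀ k l, ∀ t ∈ T, t - τ k l t ∈ T)
    (hδ_mem : ∀ k l, ∀ t ∈ T, t - δ k l t ∈ T)
    -- (H1)
    (ha_reg : ∀ i j, TimeScale.PositivelyRegressive T (fun t => -(a i j t)))
    (ha : ∀ i j, TimeScale.AlmostAutomorphic T (a i j))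
    (hB : ∀ i j k l, TimeScale.AlmostAutomorphic T (B i j k l))
    (hC : ∀ i j k l, TimeScale.AlmostAutomorphic T (C i j k l))
    (hτ : ∀ k l, TimeScale.AlmostAutomorphic T (τ k l))
    (hδ : ∀ k l, TimeScale.AlmostAutomorphic T (δ k l))
    (hL : ∀ i j, TimeScale.AlmostAutomorphic T (L i j))
    -- (H2)
    (hf_cont : Continuous f) (hg_cont : Continuous g)
    (hLf : 0 < Lf) (hLg : 0 < Lg) (hMf : 0 < Mf) (hMg : 0 < Mg)
    (hf_lip : ∀ u v, |f u - f v| ≤ Lf * |u - v|) (hf_zero : f 0 = 0)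
    (hg_lip : ∀ u v, |g u - g v| ≤ Lg * |u - v|) (hg_zero : g 0 = 0)
    (hf_bound : (∀ u, |f u| ≤ Mf * |u|) ∨ (1 ≤ ρ ∧ ∀ u, |f u| ≤ Mf))
    (hg_bound : (∀ u, |g u| ≤ Mg * |u|) ∨ (1 ≤ ρ ∧ ∀ u, |g u| ≤ Mg))
    -- (H3)
    (h_ball : ∀ i j,
      ((∑ c ∈ TimeScale.nbhd r i j,
          TimeScale.supNorm T (B i j c.1 c.2) * Mf * ρ ^ 2)
        + (∑ c ∈ TimeScale.nbhd p i j,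
          TimeScale.supNorm T (C i j c.1 c.2) * Mg * TimeScale.supNorm T (δ c.1 c.2) * ρ ^ 2)
        + TimeScale.supNorm T (L i j)) / TimeScale.infVal T (a i j) < ρ)
    (h_contr : ∀ i j,
      ((∑ c ∈ TimeScale.nbhd r i j,
          TimeScale.supNorm T (B i j c.1 c.2) * (Mf + Lf) * ρ)
        + (∑ c ∈ TimeScale.nbhd p i j,
          TimeScale.supNorm T (C i j c.1 c.2) * (Mg + Lg) * TimeScale.supNorm T (δ c.1 c.2) * ρ))
        / TimeScale.infVal T (a i j) < 1) :
    ∃ x : ℝ → Fin m → Fin n → ℝ,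
      (TimeScale.AlmostAutomorphic T x ∧ TimeScale.supNorm T x ≤ ρ ∧
        TimeScale.IsSICNNSolution T r p a L τ δ B C f g x) ∧
      ∀ y : ℝ → Fin m → Fin n → ℝ,
        TimeScale.AlmostAutomorphic T y → TimeScale.supNorm T y ≤ ρ →
        TimeScale.IsSICNNSolution T r p a L τ δ B C f g y →
        Set.EqOn y x T := by
  let N : TimeScale.Network m n := ⟨r, p, a, L, τ, δ, B, C, f, g⟩
  have hT2 := hT.isTwoSided
  have hρ : 0 ≤ ρ := N.rho_nonneg_of_forcingBound hMf.le hMg.le hm hn ha_inf h_ball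
  have hN : N.Admissible T ρ Mf Lf Mg Lg :=
    { rho_nonneg := hρ
      Lf_nonneg := hLf.le
      Mg_nonneg := hMg.le
      Lg_nonneg := hLg.le
      a_pos := ha_inf
      regressive := fun i j t ht => by
        have := (ha_reg i j).2 t ht
        linarith
      τ_mem := hτ_mem
      δ_mem := hδ_mem
      aa_a := ha
      aa_L := hL
      aa_τ := hτ
      aa_δ := hδ
      aa_B := hB
      aa_C := hC
      f_cont := hf_cont
      g_cont := hg_cont
      f_lip := hf_lip
      g_lip := hg_lip
      f_le := TimeScale.abs_le_mul_of_bound hMf.le hf_bound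
      g_le := TimeScale.abs_le_mul_of_bound hMg.le hg_bound }
  exact hN.exists_eqOn_solution hT2 hm hn h_ball h_contr
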